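/- Let $p\in\{1,\infty\}$. Let $\mathbb{H}=\mathbb{R}^3$ be the Heisenberg group with the group law $(x,y,z)\cdot(x',y',z')=(x+x',\,y+y',\,z+z'+\tfrac12(xy'-x'y))$ and the left-invariant vector fields $X=\partial_x-\tfrac y2\partial_z$, $Y=\partial_y+\tfrac x2\partial_z$. An absolutely continuous curve $\gamma:[0,1]\to\mathbb{H}$ is horizontal if $\dot\gamma(t)=u_1(t)X(\gamma(t))+u_2(t)Y(\gamma(t))$ for almost every $t$; its length is $\int_0^1\|(u_1(t),u_2(t))\|_p\,dt$, where $\|(u_1,u_2)\|_1=|u_1|+|u_2|$ and $\|(u_1,u_2)\|_\infty=\max(|u_1|,|u_2|)$; and $d(g,h)$ is the infimum of the lengths of the horizontal curves from $g$ to $h$. The $\ell^p$-Heisenberg group is $(\mathbb{H},d)$, equipped with the Lebesgue measure $\mathfrak m=\mathcal L^3$. For a metric measure space $(X,d,\mathfrak m)$, $x\in X$, $\Omega\subseteq X$ and $t\in[0,1]$, let $\Omega_t$ be the set of the points $\gamma(t)$, where $\gamma:[0,1]\to X$ is a constant speed minimising geodesic (that is, $d(\gamma(s),\gamma(s'))=|s-s'|\,d(\gamma(0),\gamma(1))$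 for all $s,s'\in[0,1]$) with $\gamma(0)=x$ and $\gamma(1)\in\Omega$. For $s>0$ let $$C_s(x)=\sup\Big\{\limsup_{t\to0^+}\frac1{t^s}\frac{\mathfrak m(\Omega_t)}{\mathfrak m(\Omega)}\ \Big|\ \Omega\text{ Borel, bounded, }0<\mathfrak m(\Omega)<\infty\Big\},$$ $$N_{\mathrm{geo}}(x)=\inf\{s>0\mid C_s(x)=+\infty\}=\sup\{s>0\mid C_s(x)=0\}\in[0,\infty].$$ The geodesic dimension of $(X,d,\mathfrak m)$ is $N_{\mathrm{geo}}=\sup_{x\in X}N_{\mathrm{geo}}(x)$. **Theorem.** The geodesic dimension of the $\ell^1$-Heisenberg group equipped with the Lebesgue measure is $4$, which is also the Hausdorff dimension of the $\ell^1$-Heisenberg group. The same holds for the $\ell^\infty$-Heisenberg group: its geodesic dimension and its Hausdorff dimension are both equal to $4$. -/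

import Mathlib

open MeasureTheory Set Filter Topology
open scoped ENNReal NNReal

/-! ## Geodesic dimension of a metric measure space -/

section GeodesicDimension

variable {X : Type*} [MetricSpace X]

/-- `γ` restricted to `[0, 1]` is a constant speed minimising geodesic. -/
def IsMinimisingGeodesic (γ : ℝ → X) : Prop :=
  ∀ s ∈ Icc (0 : ℝ) 1, ∀ t ∈ Icc (0 : ℝ) 1, dist (γ s) (γ t) = |s - t| * dist (γ 0) (γ 1)

/-- The `t`-intermediate set `Ω_t` of `Ω` from the point `x`. -/
def intermediateSet (x : X) (Ω : Set X) (t : ℝ) : Set X :=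
  {y | ∃ γ : ℝ → X, IsMinimisingGeodesic γ ∧ γ 0 = x ∧ γ 1 ∈ Ω ∧ γ t = y}

variable [MeasurableSpace X]

/-- `limsup_{t → 0⁺} t^{-s} m(Ω_t) / m(Ω)`. -/
noncomputable def contractionRate (m : Measure X) (x : X) (s : ℝ≥0) (Ω : Set X) : ℝ≥0∞ :=
  limsup (fun t : ℝ => (ENNReal.ofReal (t ^ (s : ℝ)))⁻¹ * (m (intermediateSet x Ω t) / m Ω))
    (𝓝[>] (0 : ℝ))

/-- The number `C_s(x)`: supremum of the contraction rates over the bounded Borel sets of positive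
finite measure. -/
noncomputable def contractionSup [BorelSpace X] (m : Measure X) (x : X) (s : ℝ≥0) : ℝ≥0∞ :=
  ⨆ (Ω : Set X) (_ : MeasurableSet Ω ∧ Bornology.IsBounded Ω ∧ m Ω ≠ 0 ∧ m Ω ≠ ∞),
    contractionRate m x s Ω

/-- The geodesic dimension at `x`: `inf {s > 0 | C_s(x) = ∞}` in `[0, ∞]`. -/
noncomputable def geodesicDimAt [BorelSpace X] (m : Measure X) (x : X) : ℝ≥0∞ :=
  ⨅ (s : ℝ≥0) (_ : 0 < s ∧ contractionSup m x s = ∞), (s : ℝ≥0∞)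

/-- The geodesic dimension of the metric measure space `(X, d, m)`. -/
noncomputable def geodesicDim [BorelSpace X] (m : Measure X) : ℝ≥0∞ :=
  ⨆ x : X, geodesicDimAt m x

theorem contractionSup_eq_top_of_lt [BorelSpace X] {m : Measure X} {x : X} {s s' : ℝ≥0} (h : s < s')
    (hs : contractionSup m x s ≠ 0) : contractionSup m x s' = ∞ := by
  simp only [contractionSup, ne_eq, ENNReal.iSup_eq_zero, not_forall] at hs
  obtain ⟨Ω, hΩ, h0⟩ := hs
  refine top_le_iff.1 (le_trans ?_ (le_iSup₂_of_le Ω hΩ le_rfl))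
  obtain ⟨c, hc0, hc⟩ := exists_between (pos_iff_ne_zero.2 h0)
  have hf := frequently_lt_of_lt_limsup (by isBoundedDefault) hc
  refine le_of_forall_lt fun M hM => ?_
  have hd : (0 : ℝ) < (s' : ℝ) - s := sub_pos.2 (by exact_mod_cast h)
  have hlim : Tendsto (fun t : ℝ => (ENNReal.ofReal (t ^ ((s' : ℝ) - s)))⁻¹ * c) (𝓝[>] 0)
      (𝓝 ∞) := by
    have h1 : Tendsto (fun t : ℝ => ENNReal.ofReal (t ^ ((s' : ℝ) - s))) (𝓝[>] 0) (𝓝 0) := by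
      have := (Real.continuousAt_rpow_const (0 : ℝ) ((s' : ℝ) - s) (Or.inr hd.le)).tendsto
      rw [Real.zero_rpow hd.ne'] at this
      simpa using ENNReal.tendsto_ofReal (this.mono_left nhdsWithin_le_nhds)
    have h2 := tendsto_inv_iff.2 h1
    rw [ENNReal.inv_zero] at h2
    have h3 := ENNReal.Tendsto.mul_const (b := c) h2 (Or.inl ENNReal.top_ne_zero)
    rwa [ENNReal.top_mul hc0.ne'] at h3
  obtain ⟨M', hMM', hM'⟩ := exists_between hM
  refine lt_of_lt_of_le hMM' (le_limsup_of_frequently_le ?_ (by isBoundedDefault))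
  have hev := (hlim.eventually (lt_mem_nhds hM')).and
    (eventually_mem_nhdsWithin (a := (0 : ℝ)) (s := Ioi 0))
  refine (hf.and_eventually hev).mono fun t ⟨ht1, ht2, ht3⟩ => ?_
  have ht3 : 0 < t := ht3
  refine ht2.le.trans ?_
  have hsplit : (ENNReal.ofReal (t ^ (s' : ℝ)))⁻¹
      = (ENNReal.ofReal (t ^ ((s' : ℝ) - s)))⁻¹ * (ENNReal.ofReal (t ^ (s : ℝ)))⁻¹ := by
    rw [← ENNReal.mul_inv (Or.inr ENNReal.ofReal_ne_top) (Or.inl ENNReal.ofReal_ne_top),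
      ← ENNReal.ofReal_mul (by positivity), ← Real.rpow_add ht3, sub_add_cancel]
  rw [hsplit, mul_assoc]
  gcongr

/-- The geodesic dimension at `x` is also `sup {s > 0 | C_s(x) = 0}`. -/
theorem geodesicDimAt_eq_iSup [BorelSpace X] (m : Measure X) (x : X) :
    geodesicDimAt m x = ⨆ (s : ℝ≥0) (_ : 0 < s ∧ contractionSup m x s = 0), (s : ℝ≥0∞) := by
  apply le_antisymm
  · refine le_of_forall_lt fun a ha => ?_
    obtain ⟨b, hab, hb⟩ := ENNReal.lt_iff_exists_nnreal_btwn.1 ha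
    obtain ⟨c, hbc, hc⟩ := ENNReal.lt_iff_exists_nnreal_btwn.1 hb
    have hbc' : b < c := by exact_mod_cast hbc
    have hb0 : 0 < b := by
      have : (0 : ℝ≥0∞) < b := lt_of_le_of_lt zero_le hab
      exact_mod_cast this
    have hcb : contractionSup m x b = 0 := by
      by_contra hne
      have : geodesicDimAt m x ≤ c :=
        iInf₂_le c ⟨hb0.trans hbc', contractionSup_eq_top_of_lt hbc' hne⟩
      exact absurd hc (not_lt.2 this)
    exact lt_of_lt_of_le hab (le_iSup₂_of_le b ⟨hb0, hcb⟩ le_rfl)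
  · refine iSup₂_le fun s hs => le_iInf₂ fun s' hs' => ?_
    by_contra hlt
    have hlt' : s' < s := by
      have := not_le.1 hlt
      exact_mod_cast this
    have h1 := contractionSup_eq_top_of_lt (m := m) (x := x) hlt' (by rw [hs'.2]; simp)
    rw [hs.2] at h1
    exact ENNReal.zero_ne_top h1

end GeodesicDimension

/-! ## The `ℓ^p`-Heisenberg group -/

/-- The Heisenberg group in exponential coordinates; the parameter `p` records the `ℓ^p` norm with
which its distance is defined below. -/
@[ext]
structure LpHeisenberg (p : ℝ≥0∞) where
  /-- first horizontal coordinate -/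
  x : ℝ
  /-- second horizontal coordinate -/
  y : ℝ
  /-- vertical coordinate -/
  z : ℝ

namespace LpHeisenberg

variable {p : ℝ≥0∞}

noncomputable instance : Mul (LpHeisenberg p) :=
  ⟨fun g h => ⟨g.x + h.x, g.y + h.y, g.z + h.z + (g.x * h.y - h.x * g.y) / 2⟩⟩

instance : One (LpHeisenberg p) := ⟨⟨0, 0, 0⟩⟩

instance : Inv (LpHeisenberg p) := ⟨fun g => ⟨-g.x, -g.y, -g.z⟩⟩

@[simp] theorem mul_x (g h : LpHeisenberg p) : (g * h).x = g.x + h.x := rfl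
@[simp] theorem mul_y (g h : LpHeisenberg p) : (g * h).y = g.y + h.y := rfl
@[simp] theorem mul_z (g h : LpHeisenberg p) :
    (g * h).z = g.z + h.z + (g.x * h.y - h.x * g.y) / 2 := rfl
@[simp] theorem one_x : (1 : LpHeisenberg p).x = 0 := rfl
@[simp] theorem one_y : (1 : LpHeisenberg p).y = 0 := rfl
@[simp] theorem one_z : (1 : LpHeisenberg p).z = 0 := rfl
@[simp] theorem inv_x (g : LpHeisenberg p) : (g⁻¹).x = -g.x := rfl
@[simp] theorem inv_y (g : LpHeisenberg p) : (g⁻¹).y = -g.y := rfl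
@[simp] theorem inv_z (g : LpHeisenberg p) : (g⁻¹).z = -g.z := rfl

noncomputable instance : Group (LpHeisenberg p) where
  mul_assoc a b c := by ext <;> simp <;> ring
  one_mul a := by ext <;> simp
  mul_one a := by ext <;> simp
  inv_mul_cancel a := by
    ext
    · simp
    · simp
    · simp [mul_comm]

/-- The left-invariant vector field `X = ∂_x - (y / 2) ∂_z`. -/
noncomputable def vecX (g : LpHeisenberg p) : ℝ × ℝ × ℝ := (1, 0, -(g.y / 2))

/-- The left-invariant vector field `Y = ∂_y + (x / 2) ∂_z`. -/
noncomputable def vecY (g : LpHeisenberg p) : ℝ × ℝ × ℝ := (0, 1, g.x / 2)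

/-- The velocity of a curve, in coordinates (meaningful where the coordinates are differentiable,
hence almost everywhere for an absolutely continuous curve). -/
noncomputable def velocity (γ : ℝ → LpHeisenberg p) (t : ℝ) : ℝ × ℝ × ℝ :=
  (deriv (fun s => (γ s).x) t, deriv (fun s => (γ s).y) t, deriv (fun s => (γ s).z) t)

/-- `γ` is an absolutely continuous horizontal curve on the interval with end points `a`, `b`. -/
structure IsHorizontalOn (γ : ℝ → LpHeisenberg p) (a b : ℝ) : Prop where
  ac_x : AbsolutelyContinuousOnInterval (fun t => (γ t).x) a b
  ac_y : AbsolutelyContinuousOnInterval (fun t => (γ t).y) a b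
  ac_z : AbsolutelyContinuousOnInterval (fun t => (γ t).z) a b
  horizontal : ∀ᵐ t ∂(volume.restrict (uIcc a b)),
    ∃ u₁ u₂ : ℝ, velocity γ t = u₁ • vecX (γ t) + u₂ • vecY (γ t)

variable [Fact (1 ≤ p)]

/-- The `ℓ^p` length `∫ ‖γ'(t)‖_p dt` of a horizontal curve on the interval with end points `a`,
`b`; the coefficients of `γ'` in the frame `X, Y` are the derivatives of the first two
coordinates. -/
noncomputable def length (γ : ℝ → LpHeisenberg p) (a b : ℝ) : ℝ≥0∞ :=
  ∫⁻ t in uIcc a b, ‖WithLp.toLp p ((velocity γ t).1, (velocity γ t).2.1)‖ₑ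

/-- The sub-Finsler distance: infimum of the lengths of the horizontal curves on `[0, 1]` from `g`
to `h`. -/
noncomputable def subFinslerEDist (g h : LpHeisenberg p) : ℝ≥0∞ :=
  ⨅ (γ : ℝ → LpHeisenberg p) (_ : IsHorizontalOn γ 0 1 ∧ γ 0 = g ∧ γ 1 = h), length γ 0 1

/-! ### Auxiliary facts: absolutely continuous functions -/

theorem ac_of_eq_integral {f u : ℝ → ℝ} {a b c : ℝ} (hu : IntervalIntegrable u volume a b)
    (h : ∀ t ∈ uIcc a b, f t = c + ∫ s in a..t, u s) : AbsolutelyContinuousOnInterval f a b := by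
  have h1 := hu.absolutelyContinuousOnInterval_intervalIntegral (c := a) left_mem_uIcc
  rw [absolutelyContinuousOnInterval_iff] at h1 ⊢
  intro ε hε
  obtain ⟨δ, hδ, H⟩ := h1 ε hε
  refine ⟨δ, hδ, fun E hE hlt => ?_⟩
  refine lt_of_eq_of_lt (Finset.sum_congr rfl fun i hi => ?_) (H E hE hlt)
  rw [h _ (hE.1 i hi).1, h _ (hE.1 i hi).2, dist_add_left]

theorem ac_eq_integral {f : ℝ → ℝ} {a b : ℝ} (hf : AbsolutelyContinuousOnInterval f a b)
    {t : ℝ} (ht : t ∈ uIcc a b) : f t = f a + ∫ s in a..t, deriv f s := by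
  have := (hf.mono (uIcc_subset_uIcc left_mem_uIcc ht)).integral_deriv_eq_sub
  rw [this]; ring

theorem ac_congr {f g : ℝ → ℝ} {a b : ℝ} (hf : AbsolutelyContinuousOnInterval f a b)
    (h : ∀ t ∈ uIcc a b, g t = f t) : AbsolutelyContinuousOnInterval g a b :=
  ac_of_eq_integral hf.intervalIntegrable_deriv fun t ht => (h t ht).trans (ac_eq_integral hf ht)

theorem ac_glue {f : ℝ → ℝ} {a b c : ℝ} (hab : a ≤ b) (hbc : b ≤ c)
    (h1 : AbsolutelyContinuousOnInterval f a b) (h2 : AbsolutelyContinuousOnInterval f b c) :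
    AbsolutelyContinuousOnInterval f a c := by
  have i1 := h1.intervalIntegrable_deriv
  have i2 := h2.intervalIntegrable_deriv
  refine ac_of_eq_integral (c := f a) (i1.trans i2) fun t ht => ?_
  rw [uIcc_of_le (hab.trans hbc)] at ht
  rcases le_total t b with htb | htb
  · exact ac_eq_integral h1 (by rw [uIcc_of_le hab]; exact ⟨ht.1, htb⟩)
  · have htm : t ∈ uIcc b c := by rw [uIcc_of_le hbc]; exact ⟨htb, ht.2⟩
    rw [ac_eq_integral h2 htm, ac_eq_integral h1 right_mem_uIcc, add_assoc,
      intervalIntegral.integral_add_adjacent_intervals i1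
        (i2.mono_set (uIcc_subset_uIcc left_mem_uIcc htm))]

theorem affine_mem_uIcc {m c a b t : ℝ} (ht : t ∈ uIcc a b) :
    m * t + c ∈ uIcc (m * a + c) (m * b + c) := by
  have h := mem_image_of_mem (fun s => m * s + c) ht
  have : (fun s => m * s + c) = (fun s => s + c) ∘ (fun s => m * s) := rfl
  rw [this, image_comp, image_const_mul_uIcc, image_add_const_uIcc] at h
  exact h

theorem deriv_comp_affine (f : ℝ → ℝ) (m c t : ℝ) :
    deriv (fun s => f (m * s + c)) t = m * deriv f (m * t + c) := by
  have h := deriv_comp_mul_left m (fun s => f (s + c)) t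
  rw [deriv_comp_add_const] at h
  exact h

theorem ac_comp_affine {f : ℝ → ℝ} {m c a b : ℝ} (hm : m ≠ 0)
    (hf : AbsolutelyContinuousOnInterval f (m * a + c) (m * b + c)) :
    AbsolutelyContinuousOnInterval (fun t => f (m * t + c)) a b := by
  have hi := hf.intervalIntegrable_deriv
  have hi' : IntervalIntegrable (fun s => m * deriv f (m * s + c)) volume a b := by
    have h1 := (hi.comp_add_right c).comp_mul_left (c := m)
    simp only [add_sub_cancel_right, mul_div_cancel_left₀ _ hm] at h1
    exact h1.const_mul m
  refine ac_of_eq_integral (c := f (m * a + c)) hi' fun t ht => ?_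
  rw [ac_eq_integral hf (affine_mem_uIcc ht), intervalIntegral.integral_const_mul,
    intervalIntegral.mul_integral_comp_mul_add]

/-! ### Auxiliary facts: horizontal curves -/

theorem horizontal_iff {q : ℝ≥0∞} (γ : ℝ → LpHeisenberg q) (t : ℝ) :
    (∃ u₁ u₂ : ℝ, velocity γ t = u₁ • vecX (γ t) + u₂ • vecY (γ t)) ↔
      deriv (fun s => (γ s).z) t = ((γ t).x * deriv (fun s => (γ s).y) t
        - (γ t).y * deriv (fun s => (γ s).x) t) / 2 := by
  simp only [velocity, vecX, vecY, Prod.smul_mk, Prod.mk_add_mk, Prod.mk.injEq, smul_eq_mul]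
  constructor
  · rintro ⟨u, v, h1, h2, h3⟩
    rw [h1, h2, h3]; ring
  · intro h
    exact ⟨deriv (fun s => (γ s).x) t, deriv (fun s => (γ s).y) t, by ring, by ring,
      by rw [h]; ring⟩

theorem velocity_comp_affine {q : ℝ≥0∞} (γ : ℝ → LpHeisenberg q) (m c t : ℝ) :
    velocity (fun s => γ (m * s + c)) t = m • velocity γ (m * t + c) := by
  simp only [velocity, Prod.smul_mk, smul_eq_mul]
  rw [deriv_comp_affine (fun s => (γ s).x), deriv_comp_affine (fun s => (γ s).y),
    deriv_comp_affine (fun s => (γ s).z)]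

theorem quasi_affine {m : ℝ} (hm : m ≠ 0) (c : ℝ) :
    Measure.QuasiMeasurePreserving (fun t : ℝ => m * t + c) volume volume := by
  have h1 : Measure.QuasiMeasurePreserving (fun t : ℝ => m * t) volume volume :=
    ⟨measurable_const_mul m, by
      rw [Real.map_volume_mul_left hm]; exact Measure.smul_absolutelyContinuous⟩
  exact (measurePreserving_add_right volume c).quasiMeasurePreserving.comp h1

theorem IsHorizontalOn.comp_affine {q : ℝ≥0∞} {γ : ℝ → LpHeisenberg q} {m c a b : ℝ} (hm : m ≠ 0)
    (h : IsHorizontalOn γ (m * a + c) (m * b + c)) :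
    IsHorizontalOn (fun t => γ (m * t + c)) a b where
  ac_x := ac_comp_affine (f := fun t => (γ t).x) hm h.ac_x
  ac_y := ac_comp_affine (f := fun t => (γ t).y) hm h.ac_y
  ac_z := ac_comp_affine (f := fun t => (γ t).z) hm h.ac_z
  horizontal := by
    have h1 := (ae_restrict_iff' measurableSet_uIcc).1 h.horizontal
    rw [ae_restrict_iff' measurableSet_uIcc]
    filter_upwards [(quasi_affine hm c).ae h1] with t ht hmem
    obtain ⟨u, v, huv⟩ := ht (affine_mem_uIcc hmem)
    refine ⟨m * u, m * v, ?_⟩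
    rw [velocity_comp_affine, huv, smul_add, smul_smul, smul_smul]

theorem length_comp_affine (γ : ℝ → LpHeisenberg p) {m : ℝ} (hm : m ≠ 0) (c a b : ℝ) :
    length (fun t => γ (m * t + c)) a b = length γ (m * a + c) (m * b + c) := by
  have himg : (fun t => m * t + c) '' uIcc a b = uIcc (m * a + c) (m * b + c) := by
    have : (fun s => m * s + c) = (fun s => s + c) ∘ (fun s => m * s) := rfl
    rw [this, image_comp, image_const_mul_uIcc, image_add_const_uIcc]
  unfold length
  rw [← himg, lintegral_image_eq_lintegral_abs_deriv_mul (f' := fun _ => m) measurableSet_uIcc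
    (fun t _ => by simpa using (((hasDerivAt_id t).const_mul m).add_const c).hasDerivWithinAt)
    (fun s _ t _ hst => by simpa [hm] using hst)]
  refine lintegral_congr fun t => ?_
  rw [velocity_comp_affine, Prod.smul_fst, Prod.smul_snd, Prod.smul_fst, ← Prod.smul_mk,
    WithLp.toLp_smul, enorm_smul, Real.enorm_eq_ofReal_abs]

theorem velocity_congr {q : ℝ≥0∞} {γ γ' : ℝ → LpHeisenberg q} {a b t : ℝ}
    (h : ∀ t ∈ Icc a b, γ' t = γ t) (ht : t ∈ Ioo a b) : velocity γ' t = velocity γ t := by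
  have he : γ' =ᶠ[𝓝 t] γ := by
    filter_upwards [Ioo_mem_nhds ht.1 ht.2] with s hs using h s (Ioo_subset_Icc_self hs)
  have hx : (fun s => (γ' s).x) =ᶠ[𝓝 t] fun s => (γ s).x := he.fun_comp LpHeisenberg.x
  have hy : (fun s => (γ' s).y) =ᶠ[𝓝 t] fun s => (γ s).y := he.fun_comp LpHeisenberg.y
  have hz : (fun s => (γ' s).z) =ᶠ[𝓝 t] fun s => (γ s).z := he.fun_comp LpHeisenberg.z
  unfold velocity
  rw [hx.deriv_eq, hy.deriv_eq, hz.deriv_eq]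

theorem IsHorizontalOn.congr {q : ℝ≥0∞} {γ γ' : ℝ → LpHeisenberg q} {a b : ℝ} (hab : a ≤ b)
    (hγ : IsHorizontalOn γ a b) (h : ∀ t ∈ Icc a b, γ' t = γ t) : IsHorizontalOn γ' a b where
  ac_x := ac_congr hγ.ac_x fun t ht => by rw [h t (by rwa [uIcc_of_le hab] at ht)]
  ac_y := ac_congr hγ.ac_y fun t ht => by rw [h t (by rwa [uIcc_of_le hab] at ht)]
  ac_z := ac_congr hγ.ac_z fun t ht => by rw [h t (by rwa [uIcc_of_le hab] at ht)]
  horizontal := by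
    have h1 := hγ.horizontal
    rw [uIcc_of_le hab, ← Measure.restrict_congr_set Ioo_ae_eq_Icc,
      ae_restrict_iff' measurableSet_Ioo] at h1 ⊢
    filter_upwards [h1] with t ht hmem
    rw [velocity_congr h hmem, h t (Ioo_subset_Icc_self hmem)]
    exact ht hmem

theorem length_congr {γ γ' : ℝ → LpHeisenberg p} {a b : ℝ} (hab : a ≤ b)
    (h : ∀ t ∈ Icc a b, γ' t = γ t) : length γ' a b = length γ a b := by
  unfold length
  rw [uIcc_of_le hab, ← Measure.restrict_congr_set Ioo_ae_eq_Icc]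
  exact setLIntegral_congr_fun measurableSet_Ioo fun t ht => by
    simp only [velocity_congr h ht]

theorem IsHorizontalOn.glue {q : ℝ≥0∞} {γ : ℝ → LpHeisenberg q} {a b c : ℝ} (hab : a ≤ b)
    (hbc : b ≤ c) (h1 : IsHorizontalOn γ a b) (h2 : IsHorizontalOn γ b c) :
    IsHorizontalOn γ a c where
  ac_x := ac_glue hab hbc h1.ac_x h2.ac_x
  ac_y := ac_glue hab hbc h1.ac_y h2.ac_y
  ac_z := ac_glue hab hbc h1.ac_z h2.ac_z
  horizontal := by
    have e1 := h1.horizontal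
    have e2 := h2.horizontal
    rw [uIcc_of_le hab] at e1
    rw [uIcc_of_le hbc] at e2
    rw [uIcc_of_le (hab.trans hbc), ← Icc_union_Icc_eq_Icc hab hbc, ae_restrict_union_iff]
    exact ⟨e1, e2⟩

theorem length_glue_le (γ : ℝ → LpHeisenberg p) {a b c : ℝ} (hab : a ≤ b) (hbc : b ≤ c) :
    length γ a c ≤ length γ a b + length γ b c := by
  unfold length
  rw [uIcc_of_le hab, uIcc_of_le hbc, uIcc_of_le (hab.trans hbc),
    ← Icc_union_Icc_eq_Icc hab hbc]
  exact lintegral_union_le _ _ _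

theorem exists_concat {γ₁ γ₂ : ℝ → LpHeisenberg p} (h1 : IsHorizontalOn γ₁ 0 1)
    (h2 : IsHorizontalOn γ₂ 0 1) (h : γ₁ 1 = γ₂ 0) :
    ∃ γ : ℝ → LpHeisenberg p, IsHorizontalOn γ 0 1 ∧ γ 0 = γ₁ 0 ∧ γ 1 = γ₂ 1 ∧
      length γ 0 1 ≤ length γ₁ 0 1 + length γ₂ 0 1 := by
  let γ : ℝ → LpHeisenberg p := fun t => if t ≤ 1 / 2 then γ₁ (2 * t + 0) else γ₂ (2 * t + (-1))
  have c1 : ∀ t ∈ Icc (0 : ℝ) (1 / 2), γ t = γ₁ (2 * t + 0) := fun t ht => if_pos ht.2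
  have c2 : ∀ t ∈ Icc (1 / 2 : ℝ) 1, γ t = γ₂ (2 * t + (-1)) := by
    intro t ht
    rcases ht.1.eq_or_lt with rfl | hlt
    · simp only [γ, le_refl, if_true]
      norm_num [h]
    · exact if_neg (not_le.2 hlt)
  have g1 : IsHorizontalOn γ 0 (1 / 2) := by
    refine IsHorizontalOn.congr (by norm_num) (IsHorizontalOn.comp_affine two_ne_zero ?_) c1
    norm_num; exact h1
  have g2 : IsHorizontalOn γ (1 / 2) 1 := by
    refine IsHorizontalOn.congr (by norm_num) (IsHorizontalOn.comp_affine two_ne_zero ?_) c2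
    norm_num; exact h2
  refine ⟨γ, g1.glue (by norm_num) (by norm_num) g2, ?_, ?_, ?_⟩
  · rw [c1 0 (by norm_num)]; norm_num
  · rw [c2 1 (by norm_num)]; norm_num
  · refine (length_glue_le γ (b := 1 / 2) (by norm_num) (by norm_num)).trans (le_of_eq ?_)
    rw [length_congr (by norm_num) c1, length_congr (by norm_num) c2,
      length_comp_affine _ two_ne_zero, length_comp_affine _ two_ne_zero]
    norm_num

theorem subFinslerEDist_triangle (g h k : LpHeisenberg p) :
    subFinslerEDist g k ≤ subFinslerEDist g h + subFinslerEDist h k := by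
  unfold subFinslerEDist
  simp only [ENNReal.iInf_add, ENNReal.add_iInf]
  refine le_iInf fun γ₂ => le_iInf fun h2 => le_iInf fun γ₁ => le_iInf fun h1 => ?_
  obtain ⟨γ, hγ, e0, e1, hl⟩ := exists_concat h1.1 h2.1 (h1.2.2.trans h2.2.1.symm)
  exact iInf₂_le_of_le γ ⟨hγ, e0.trans h1.2.1, e1.trans h2.2.2⟩ hl

theorem subFinslerEDist_comm_le (g h : LpHeisenberg p) :
    subFinslerEDist g h ≤ subFinslerEDist h g := by
  refine le_iInf₂ fun γ hγ => ?_
  have hl := length_comp_affine γ (m := -1) (by norm_num) 1 0 1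
  norm_num at hl
  refine iInf₂_le_of_le (fun t => γ ((-1) * t + 1)) ⟨?_, ?_, ?_⟩ ?_
  · refine IsHorizontalOn.comp_affine (by norm_num) ?_
    obtain ⟨⟨hx, hy, hz, hh⟩, -, -⟩ := hγ
    norm_num
    exact ⟨hx.symm, hy.symm, hz.symm, by rwa [uIcc_comm]⟩
  · norm_num; exact hγ.2.2
  · norm_num; exact hγ.2.1
  · norm_num
    rw [hl]
    unfold length
    rw [uIcc_comm]

theorem enorm_le_add (a b : ℝ) : ‖WithLp.toLp p (a, b)‖ₑ ≤ ‖a‖ₑ + ‖b‖ₑ := by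
  have h : WithLp.toLp p (a, b) = WithLp.toLp p (a, 0) + WithLp.toLp p (0, b) := by
    rw [← WithLp.toLp_add]; simp
  rw [h]
  refine (enorm_add_le _ _).trans (le_of_eq ?_)
  rw [← ofReal_norm, ← ofReal_norm, WithLp.norm_toLp_fst, WithLp.norm_toLp_snd,
    ofReal_norm, ofReal_norm]

/-! ### Auxiliary facts: bounds for the distance -/

theorem enorm_sub_le_lintegral {f : ℝ → ℝ} {F : ℝ → ℝ≥0∞}
    (hf : AbsolutelyContinuousOnInterval f 0 1)
    (hF : ∀ᵐ s ∂(volume.restrict (uIcc (0 : ℝ) 1)), ‖deriv f s‖ₑ ≤ F s) {t : ℝ}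
    (ht : t ∈ Icc (0 : ℝ) 1) : ‖f t - f 0‖ₑ ≤ ∫⁻ s in uIcc (0 : ℝ) 1, F s := by
  have e : f t - f 0 = ∫ s in (0 : ℝ)..t, deriv f s := by
    rw [ac_eq_integral hf (by rwa [uIcc_of_le zero_le_one])]; ring
  rw [e, intervalIntegral.integral_of_le ht.1]
  refine (enorm_integral_le_lintegral_enorm _).trans ?_
  refine (lintegral_mono_set ?_).trans (lintegral_mono_ae hF)
  rw [uIcc_of_le zero_le_one]
  exact fun s hs => ⟨hs.1.le, hs.2.trans ht.2⟩

theorem enorm_x_sub_le {γ : ℝ → LpHeisenberg p} (h : IsHorizontalOn γ 0 1) {t : ℝ}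
    (ht : t ∈ Icc (0 : ℝ) 1) : ‖(γ t).x - (γ 0).x‖ₑ ≤ length γ 0 1 :=
  enorm_sub_le_lintegral h.ac_x (ae_of_all _ fun s =>
    WithLp.enorm_fst_le (p := p) (α := ℝ) (β := ℝ)
      (x := WithLp.toLp p ((velocity γ s).1, (velocity γ s).2.1))) ht

theorem enorm_y_sub_le {γ : ℝ → LpHeisenberg p} (h : IsHorizontalOn γ 0 1) {t : ℝ}
    (ht : t ∈ Icc (0 : ℝ) 1) : ‖(γ t).y - (γ 0).y‖ₑ ≤ length γ 0 1 :=
  enorm_sub_le_lintegral h.ac_y (ae_of_all _ fun s =>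
    WithLp.enorm_snd_le (p := p) (α := ℝ) (β := ℝ)
      (x := WithLp.toLp p ((velocity γ s).1, (velocity γ s).2.1))) ht

/-- The vertical coordinate of `g⁻¹ * h`. -/
noncomputable def vert (g h : LpHeisenberg p) : ℝ :=
  h.z - g.z - (g.x * (h.y - g.y) - g.y * (h.x - g.x)) / 2

theorem abs_vert_le {γ : ℝ → LpHeisenberg p} (h : IsHorizontalOn γ 0 1)
    (hL : length γ 0 1 ≠ ∞) : |vert (γ 0) (γ 1)| ≤ (length γ 0 1).toReal ^ 2 := by
  set L := (length γ 0 1).toReal with hLdef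
  have hL0 : 0 ≤ L := ENNReal.toReal_nonneg
  have hLe : length γ 0 1 = ENNReal.ofReal L := (ENNReal.ofReal_toReal hL).symm
  let w : ℝ → ℝ := fun s => (γ s).z - ((γ 0).x / 2 * (γ s).y - (γ 0).y / 2 * (γ s).x)
  have hw : AbsolutelyContinuousOnInterval w 0 1 :=
    h.ac_z.fun_sub ((h.ac_y.const_mul _).fun_sub (h.ac_x.const_mul _))
  have key : ∀ᵐ s ∂(volume.restrict (uIcc (0 : ℝ) 1)), ‖deriv w s‖ₑ ≤
      ENNReal.ofReal L * ‖WithLp.toLp p ((velocity γ s).1, (velocity γ s).2.1)‖ₑ := by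
    have e1 := h.horizontal
    rw [ae_restrict_iff' measurableSet_uIcc] at e1 ⊢
    filter_upwards [e1, h.ac_x.ae_differentiableAt, h.ac_y.ae_differentiableAt,
      h.ac_z.ae_differentiableAt] with s e1 dx dy dz hs
    have hz := (horizontal_iff γ s).1 (e1 hs)
    have hd : deriv w s = deriv (fun s => (γ s).z) s - ((γ 0).x / 2 * deriv (fun s => (γ s).y) s
        - (γ 0).y / 2 * deriv (fun s => (γ s).x) s) :=
      ((dz hs).hasDerivAt.sub
        (((dy hs).hasDerivAt.const_mul _).sub ((dx hs).hasDerivAt.const_mul _))).deriv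
    have hs' : s ∈ Icc (0 : ℝ) 1 := by rwa [uIcc_of_le zero_le_one] at hs
    have bx := enorm_x_sub_le h hs'
    have bY := enorm_y_sub_le h hs'
    rw [hLe, Real.enorm_eq_ofReal_abs, ENNReal.ofReal_le_ofReal_iff hL0] at bx bY
    have nx := WithLp.norm_fst_le (p := p) (α := ℝ) (β := ℝ)
      (x := WithLp.toLp p ((velocity γ s).1, (velocity γ s).2.1))
    have ny := WithLp.norm_snd_le (p := p) (α := ℝ) (β := ℝ)
      (x := WithLp.toLp p ((velocity γ s).1, (velocity γ s).2.1))
    simp only [velocity, Real.norm_eq_abs] at nx ny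
    rw [← ofReal_norm (WithLp.toLp p _), ← ENNReal.ofReal_mul hL0, Real.enorm_eq_ofReal_abs]
    refine ENNReal.ofReal_le_ofReal ?_
    rw [hd, hz]
    simp only [velocity]
    generalize ‖WithLp.toLp p (deriv (fun s => (γ s).x) s, deriv (fun s => (γ s).y) s)‖ = N at *
    generalize deriv (fun s => (γ s).x) s = u at *
    generalize deriv (fun s => (γ s).y) s = v at *
    have e : ((γ s).x * v - (γ s).y * u) / 2 - ((γ 0).x / 2 * v - (γ 0).y / 2 * u)
        = (((γ s).x - (γ 0).x) * v - ((γ s).y - (γ 0).y) * u) / 2 := by ring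
    rw [e, abs_div, abs_two, div_le_iff₀ two_pos]
    refine (abs_sub _ _).trans ?_
    rw [abs_mul, abs_mul]
    have m1 : |(γ s).x - (γ 0).x| * |v| ≤ L * N := mul_le_mul bx ny (abs_nonneg _) hL0
    have m2 : |(γ s).y - (γ 0).y| * |u| ≤ L * N := mul_le_mul bY nx (abs_nonneg _) hL0
    linarith
  have hfin := enorm_sub_le_lintegral hw key (t := 1) (by norm_num)
  rw [lintegral_const_mul' _ _ ENNReal.ofReal_ne_top] at hfin
  have hfin' : ‖w 1 - w 0‖ₑ ≤ ENNReal.ofReal L * length γ 0 1 := hfin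
  rw [hLe, ← ENNReal.ofReal_mul hL0, Real.enorm_eq_ofReal_abs,
    ENNReal.ofReal_le_ofReal_iff (by positivity)] at hfin'
  have e : vert (γ 0) (γ 1) = w 1 - w 0 := by simp only [vert, w]; ring
  rw [e, sq]
  exact hfin'

theorem enorm_x_le_subFinslerEDist (g h : LpHeisenberg p) :
    ‖h.x - g.x‖ₑ ≤ subFinslerEDist g h := by
  refine le_iInf₂ fun γ hγ => ?_
  have := enorm_x_sub_le hγ.1 (t := 1) (by norm_num)
  rwa [hγ.2.1, hγ.2.2] at this

theorem enorm_y_le_subFinslerEDist (g h : LpHeisenberg p) :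
    ‖h.y - g.y‖ₑ ≤ subFinslerEDist g h := by
  refine le_iInf₂ fun γ hγ => ?_
  have := enorm_y_sub_le hγ.1 (t := 1) (by norm_num)
  rwa [hγ.2.1, hγ.2.2] at this

theorem sqrt_vert_le_subFinslerEDist (g h : LpHeisenberg p) :
    ENNReal.ofReal (√|vert g h|) ≤ subFinslerEDist g h := by
  refine le_iInf₂ fun γ hγ => ?_
  by_cases hL : length γ 0 1 = ∞
  · rw [hL]; exact le_top
  have := abs_vert_le hγ.1 hL
  rw [hγ.2.1, hγ.2.2] at this
  rw [← ENNReal.ofReal_toReal hL]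
  exact ENNReal.ofReal_le_ofReal (Real.sqrt_le_iff.2 ⟨ENNReal.toReal_nonneg, this⟩)

theorem hasDerivAt_quintic (c₀ c₁ c₂ c₃ c₄ c₅ t : ℝ) :
    HasDerivAt (fun t : ℝ => c₀ + c₁ * t + c₂ * t ^ 2 + c₃ * t ^ 3 + c₄ * t ^ 4 + c₅ * t ^ 5)
      (c₁ + 2 * c₂ * t + 3 * c₃ * t ^ 2 + 4 * c₄ * t ^ 3 + 5 * c₅ * t ^ 4) t := by
  have h (n : ℕ) (c : ℝ) := (hasDerivAt_pow n t).const_mul c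
  have := ((((((hasDerivAt_id t).const_mul c₁).const_add c₀).add (h 2 c₂)).add (h 3 c₃)).add
    (h 4 c₄)).add (h 5 c₅)
  refine this.congr_deriv ?_
  norm_num
  ring

theorem ac_quintic (c₀ c₁ c₂ c₃ c₄ c₅ : ℝ) : AbsolutelyContinuousOnInterval
    (fun t : ℝ => c₀ + c₁ * t + c₂ * t ^ 2 + c₃ * t ^ 3 + c₄ * t ^ 4 + c₅ * t ^ 5) 0 1 :=
  ContDiffOn.absolutelyContinuousOnInterval (ContDiff.contDiffOn (by fun_prop))

theorem subFinslerEDist_le (g h : LpHeisenberg p) : subFinslerEDist g h ≤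
    ENNReal.ofReal (|h.x - g.x| + 6 * |h.y - g.y| + 31 * √|vert g h|) := by
  obtain ⟨c, hc⟩ : ∃ c, c = -vert g h := ⟨_, rfl⟩
  obtain ⟨a, ha⟩ : ∃ a, a = h.x - g.x := ⟨_, rfl⟩
  obtain ⟨b, hb⟩ : ∃ b, b = h.y - g.y := ⟨_, rfl⟩
  obtain ⟨l, k, hl, hk, hlk⟩ : ∃ l k : ℝ, |l| ≤ √|c| ∧ |k| ≤ 5 * |b| + 30 * √|c| ∧
      l * b / 3 - l * k / 15 = -2 * c := by
    rcases le_total 0 c with h0 | h0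
    · refine ⟨√c, 5 * b + 30 * √c, ?_, ?_, ?_⟩
      · rw [abs_of_nonneg (Real.sqrt_nonneg _), abs_of_nonneg h0]
      · refine (abs_add_le _ _).trans (le_of_eq ?_)
        rw [abs_mul, abs_mul, abs_of_nonneg (Real.sqrt_nonneg _), abs_of_nonneg h0]
        norm_num
      · linear_combination (-2) * Real.mul_self_sqrt h0
    · have h0' : 0 ≤ -c := by linarith
      refine ⟨√(-c), 5 * b - 30 * √(-c), ?_, ?_, ?_⟩
      · rw [abs_of_nonneg (Real.sqrt_nonneg _), abs_of_nonpos h0]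
      · refine (abs_sub _ _).trans (le_of_eq ?_)
        rw [abs_mul, abs_mul, abs_of_nonneg (Real.sqrt_nonneg _), abs_of_nonpos h0]
        norm_num
      · linear_combination 2 * Real.mul_self_sqrt h0'
  let γ : ℝ → LpHeisenberg p := fun t =>
    ⟨g.x + (a + l) * t + (-l) * t ^ 2 + 0 * t ^ 3 + 0 * t ^ 4 + 0 * t ^ 5,
     g.y + (b + k) * t + (-3 * k) * t ^ 2 + (2 * k) * t ^ 3 + 0 * t ^ 4 + 0 * t ^ 5,
     g.z + ((g.x * (b + k) - g.y * (a + l)) / 2) * t + ((-3 * k * g.x + l * g.y) / 2) * t ^ 2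
      + ((2 * k * g.x + l * (b + k) / 3 - (a + l) * k) / 2) * t ^ 3
      + ((a + l) * k / 2) * t ^ 4 + (-(l * k) / 5) * t ^ 5⟩
  have dx (t : ℝ) : deriv (fun s => (γ s).x) t = _ := (hasDerivAt_quintic _ _ _ _ _ _ t).deriv
  have dy (t : ℝ) : deriv (fun s => (γ s).y) t = _ := (hasDerivAt_quintic _ _ _ _ _ _ t).deriv
  have dz (t : ℝ) : deriv (fun s => (γ s).z) t = _ := (hasDerivAt_quintic _ _ _ _ _ _ t).deriv
  have hγ : IsHorizontalOn γ 0 1 := by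
    refine ⟨ac_quintic _ _ _ _ _ _, ac_quintic _ _ _ _ _ _, ac_quintic _ _ _ _ _ _,
      ae_of_all _ fun t => (horizontal_iff γ t).2 ?_⟩
    rw [dx, dy, dz]
    simp only [γ]
    ring
  have h0 : γ 0 = g := by ext <;> simp [γ]
  have h1 : γ 1 = h := by
    ext
    · simp only [γ]; rw [ha]; ring
    · simp only [γ]; rw [hb]; ring
    · simp only [γ]
      simp only [vert, ← ha, ← hb] at hc
      linear_combination (1 / 2) * hlk - hc
  refine (iInf₂_le γ ⟨hγ, h0, h1⟩).trans ?_
  unfold length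
  have hsq : √|vert g h| = √|c| := by rw [hc, abs_neg]
  rw [hsq, ← ha, ← hb]
  calc ∫⁻ t in uIcc (0 : ℝ) 1, ‖WithLp.toLp p ((velocity γ t).1, (velocity γ t).2.1)‖ₑ
      ≤ ∫⁻ _ in uIcc (0 : ℝ) 1, ENNReal.ofReal (|a| + 6 * |b| + 31 * √|c|) := by
        refine setLIntegral_mono' measurableSet_uIcc fun t ht => ?_
        rw [uIcc_of_le zero_le_one] at ht
        refine (enorm_le_add _ _).trans ?_
        rw [Real.enorm_eq_ofReal_abs, Real.enorm_eq_ofReal_abs,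
          ← ENNReal.ofReal_add (abs_nonneg _) (abs_nonneg _)]
        refine ENNReal.ofReal_le_ofReal ?_
        simp only [velocity]
        rw [dx, dy]
        have e1 : |a + l + 2 * (-l) * t + 3 * 0 * t ^ 2 + 4 * 0 * t ^ 3 + 5 * 0 * t ^ 4|
            ≤ |a| + |l| := by
          have : a + l + 2 * (-l) * t + 3 * 0 * t ^ 2 + 4 * 0 * t ^ 3 + 5 * 0 * t ^ 4
            = a + l * (1 - 2 * t) := by ring
          rw [this]
          refine (abs_add_le _ _).trans ?_
          rw [abs_mul]
          have : |1 - 2 * t| ≤ 1 := abs_le.2 ⟨by linarith [ht.2], by linarith [ht.1]⟩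
          have := mul_le_mul_of_nonneg_left this (abs_nonneg l)
          linarith
        have e2 : |b + k + 2 * (-3 * k) * t + 3 * (2 * k) * t ^ 2 + 4 * 0 * t ^ 3 + 5 * 0 * t ^ 4|
            ≤ |b| + |k| := by
          have : b + k + 2 * (-3 * k) * t + 3 * (2 * k) * t ^ 2 + 4 * 0 * t ^ 3 + 5 * 0 * t ^ 4
            = b + k * (1 - 6 * t + 6 * t ^ 2) := by ring
          rw [this]
          refine (abs_add_le _ _).trans ?_
          rw [abs_mul]
          have : |1 - 6 * t + 6 * t ^ 2| ≤ 1 :=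
            abs_le.2 ⟨by nlinarith [sq_nonneg (t - 1 / 2)], by nlinarith [ht.1, ht.2]⟩
          have := mul_le_mul_of_nonneg_left this (abs_nonneg k)
          linarith
        linarith
    _ = ENNReal.ofReal (|a| + 6 * |b| + 31 * √|c|) := by
        rw [lintegral_const, Measure.restrict_apply_univ, uIcc_of_le zero_le_one,
          Real.volume_Icc]
        simp

/-! ### The metric measure space -/

/-- The `ℓ^p`-Heisenberg group with the distance induced by its sub-Finsler structure. -/
noncomputable instance : MetricSpace (LpHeisenberg p) :=
  letI : EMetricSpace (LpHeisenberg p) :=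
    { edist := subFinslerEDist
      edist_self := fun g => by
        have := subFinslerEDist_le g g
        simpa [vert] using this
      edist_comm := fun g h => le_antisymm (subFinslerEDist_comm_le g h)
        (subFinslerEDist_comm_le h g)
      edist_triangle := subFinslerEDist_triangle
      eq_of_edist_eq_zero := fun {g h} h0 => by
        have h0 : subFinslerEDist g h = 0 := h0
        have hx := enorm_x_le_subFinslerEDist g h
        have hy := enorm_y_le_subFinslerEDist g h
        have hz := sqrt_vert_le_subFinslerEDist g h
        rw [h0, nonpos_iff_eq_zero, enorm_eq_zero, sub_eq_zero] at hx hy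
        rw [h0, nonpos_iff_eq_zero, ENNReal.ofReal_eq_zero, Real.sqrt_le_iff] at hz
        have hz : vert g h = 0 := abs_nonpos_iff.1 (by simpa using hz.2)
        simp only [vert, hx, hy, sub_self, mul_zero, zero_div, sub_zero, sub_eq_zero] at hz
        exact LpHeisenberg.ext hx.symm hy.symm hz.symm }
  EMetricSpace.toMetricSpace fun g h =>
    ((subFinslerEDist_le g h).trans_lt ENNReal.ofReal_lt_top).ne

theorem edist_def (g h : LpHeisenberg p) : edist g h = subFinslerEDist g h := rfl

theorem dist_def (g h : LpHeisenberg p) : dist g h = (subFinslerEDist g h).toReal := rfl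

/-- Exponential coordinates. -/
def coordEquiv (q : ℝ≥0∞) : LpHeisenberg q ≃ ℝ × ℝ × ℝ where
  toFun g := (g.x, g.y, g.z)
  invFun v := ⟨v.1, v.2.1, v.2.2⟩
  left_inv _ := rfl
  right_inv _ := rfl

theorem dist_le (g h : LpHeisenberg p) :
    dist g h ≤ |h.x - g.x| + 6 * |h.y - g.y| + 31 * √|vert g h| := by
  have := subFinslerEDist_le g h
  rw [← edist_def, edist_dist] at this
  exact (ENNReal.ofReal_le_ofReal_iff (by positivity)).1 this

theorem abs_x_sub_le_dist (g h : LpHeisenberg p) : |h.x - g.x| ≤ dist g h := by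
  have := enorm_x_le_subFinslerEDist g h
  rwa [← edist_def, edist_dist, Real.enorm_eq_ofReal_abs,
    ENNReal.ofReal_le_ofReal_iff dist_nonneg] at this

theorem abs_y_sub_le_dist (g h : LpHeisenberg p) : |h.y - g.y| ≤ dist g h := by
  have := enorm_y_le_subFinslerEDist g h
  rwa [← edist_def, edist_dist, Real.enorm_eq_ofReal_abs,
    ENNReal.ofReal_le_ofReal_iff dist_nonneg] at this

theorem abs_vert_le_dist_sq (g h : LpHeisenberg p) : |vert g h| ≤ dist g h ^ 2 := by
  have := sqrt_vert_le_subFinslerEDist g h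
  rw [← edist_def, edist_dist, ENNReal.ofReal_le_ofReal_iff dist_nonneg] at this
  exact (Real.sqrt_le_iff.1 this).2

/-- The sub-Finsler distance induces the Euclidean topology. -/
noncomputable def coordHomeomorph (q : ℝ≥0∞) [Fact (1 ≤ q)] : LpHeisenberg q ≃ₜ ℝ × ℝ × ℝ where
  toEquiv := coordEquiv q
  continuous_toFun := by
    rw [continuous_iff_continuousAt]
    intro g
    have hd : Tendsto (fun h : LpHeisenberg q => dist g h) (𝓝 g) (𝓝 0) := by
      have : Continuous fun h : LpHeisenberg q => dist g h := by fun_prop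
      simpa using this.tendsto g
    have hx : Tendsto (fun h : LpHeisenberg q => h.x - g.x) (𝓝 g) (𝓝 0) :=
      squeeze_zero_norm (fun h => abs_x_sub_le_dist g h) hd
    have hy : Tendsto (fun h : LpHeisenberg q => h.y - g.y) (𝓝 g) (𝓝 0) :=
      squeeze_zero_norm (fun h => abs_y_sub_le_dist g h) hd
    have hv : Tendsto (fun h : LpHeisenberg q => vert g h) (𝓝 g) (𝓝 0) :=
      squeeze_zero_norm (fun h => abs_vert_le_dist_sq g h) (by simpa using hd.pow 2)
    have hz : Tendsto (fun h : LpHeisenberg q => h.z) (𝓝 g) (𝓝 g.z) := by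
      have := (hv.add (((hy.const_mul g.x).sub (hx.const_mul g.y)).div_const 2)).add_const g.z
      simp only [mul_zero, sub_zero, zero_div, zero_add] at this
      refine this.congr fun h => ?_
      simp only [vert]; ring
    have hx' : Tendsto (fun h : LpHeisenberg q => h.x) (𝓝 g) (𝓝 g.x) :=
      tendsto_sub_nhds_zero_iff.1 hx
    have hy' : Tendsto (fun h : LpHeisenberg q => h.y) (𝓝 g) (𝓝 g.y) :=
      tendsto_sub_nhds_zero_iff.1 hy
    exact hx'.prodMk_nhds (hy'.prodMk_nhds hz)
  continuous_invFun := by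
    rw [continuous_iff_continuousAt]
    intro v
    refine tendsto_iff_dist_tendsto_zero.2 ?_
    refine squeeze_zero (fun _ => dist_nonneg) (fun w => (dist_comm _ _).trans_le
      (dist_le _ _)) ?_
    have : Continuous fun w : ℝ × ℝ × ℝ => |w.1 - v.1| + 6 * |w.2.1 - v.2.1| +
        31 * √|w.2.2 - v.2.2 - (v.1 * (w.2.1 - v.2.1) - v.2.1 * (w.1 - v.1)) / 2| := by fun_prop
    have h2 := this.tendsto v
    simp only [sub_self, abs_zero, mul_zero, zero_div, Real.sqrt_zero, add_zero] at h2
    exact h2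

noncomputable instance : MeasurableSpace (LpHeisenberg p) := borel _

instance : BorelSpace (LpHeisenberg p) := ⟨rfl⟩

/-- The Lebesgue measure `ℒ³` in exponential coordinates. -/
noncomputable instance : MeasureSpace (LpHeisenberg p) where
  volume := Measure.map (coordHomeomorph p).symm (volume : Measure (ℝ × ℝ × ℝ))

theorem volume_apply (Ω : Set (LpHeisenberg p)) :
    volume Ω = volume {v : ℝ × ℝ × ℝ | (⟨v.1, v.2.1, v.2.2⟩ : LpHeisenberg p) ∈ Ω} :=
  (coordHomeomorph p).symm.toMeasurableEquiv.map_apply Ω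

end LpHeisenberg

namespace LpHeisenberg

/-! ### Volume of boxes -/

/-! Both dimensions are 4 because the ball of radius `r` about `g` is comparable, in the coordinates
of `g⁻¹ * h`, to a box with sides of order `r`, `r`, `r ^ 2`. Left translation preserves Lebesgue
measure, so balls have volume of order `r ^ 4`. This gives the Hausdorff dimension: the volume bound
is a mass distribution estimate from below, and a left-invariant grid with order `N ^ 4` cells of
diameter of order `1 / N` gives the bound from above.

It also gives half of the geodesic dimension: `Ω_t` lies in a ball of radius `t * R`, so its volume
is at most a constant times `t ^ 4`, and `C_s` vanishes for `s < 4` (`contractionRate_eq_zero`).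

The other half uses that the two norms are not strictly convex, so minimisers abound. For `ℓ¹`,
every horizontal curve with nonnegative controls minimises, since `x + y` is 1-Lipschitz; for `ℓ^∞`,
so does every curve whose first control is nonnegative and dominates the second, since `x` is
1-Lipschitz. The second control can thus oscillate at any frequency. At frequency `π / t` the curve
has enclosed an area of order `t ^ 2` by time `t`, with an amplitude that does not depend on `t`.
Letting the parameters vary, the points at time `t` fill a box of volume `t ^ 4 / 40` while the end
points stay in a fixed ball (`HasDilatedGeodesics`). Hence `C_4` is nonzero and `C_s = ∞` for `s >
4`. -/

theorem measurePreserving_leftCoord (q : ℝ≥0∞) [Fact (1 ≤ q)] (g : LpHeisenberg q) :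
    MeasurePreserving (fun h : LpHeisenberg q => (h.x - g.x, h.y - g.y, vert g h))
      volume volume := by
  have hz (c : ℝ) : MeasurePreserving (fun z : ℝ => z - c) volume volume :=
    measurePreserving_sub_right volume c
  -- Left translation is a triangular shear: each coordinate is shifted by an amount depending only
  -- on the previous ones, so two skew products suffice.
  have hyz (x : ℝ) : MeasurePreserving
      (fun w : ℝ × ℝ => (w.1 - g.y,
        w.2 - (g.z + (g.x * (w.1 - g.y) - g.y * (x - g.x)) / 2))) volume volume :=
    MeasurePreserving.skew_product (f := fun y : ℝ => y - g.y)
      (g := fun y z => z - (g.z + (g.x * (y - g.y) - g.y * (x - g.x)) / 2)) (hz _)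
      (by simp only [Function.uncurry_def]; fun_prop) (ae_of_all _ fun y => (hz _).map_eq)
  have hxyz : MeasurePreserving
      (fun v : ℝ × ℝ × ℝ => (v.1 - g.x, v.2.1 - g.y,
        v.2.2 - (g.z + (g.x * (v.2.1 - g.y) - g.y * (v.1 - g.x)) / 2))) volume volume :=
    MeasurePreserving.skew_product (f := fun x : ℝ => x - g.x)
      (g := fun x (w : ℝ × ℝ) => (w.1 - g.y,
        w.2 - (g.z + (g.x * (w.1 - g.y) - g.y * (x - g.x)) / 2))) (hz _)
      (by simp only [Function.uncurry_def]; fun_prop) (ae_of_all _ fun x => (hyz x).map_eq)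
  have hc : MeasurePreserving (coordHomeomorph q) volume volume := by
    have : MeasurePreserving (coordHomeomorph q).symm.toMeasurableEquiv volume volume :=
      ⟨(coordHomeomorph q).symm.toMeasurableEquiv.measurable, rfl⟩
    exact this.symm
  convert hxyz.comp hc using 1
  funext h
  have hh : coordHomeomorph q h = (h.x, h.y, h.z) := rfl
  simp only [Function.comp, hh, vert, sub_sub]

theorem volume_leftBox (q : ℝ≥0∞) [Fact (1 ≤ q)] (g : LpHeisenberg q) {I J K : Set ℝ}
    (hI : MeasurableSet I) (hJ : MeasurableSet J) (hK : MeasurableSet K) :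
    volume {h : LpHeisenberg q | h.x - g.x ∈ I ∧ h.y - g.y ∈ J ∧ vert g h ∈ K} =
      volume I * (volume J * volume K) := by
  have h := (measurePreserving_leftCoord q g).measure_preimage
    (hI.prod (hJ.prod hK)).nullMeasurableSet
  rw [Measure.volume_eq_prod, Measure.prod_prod, Measure.volume_eq_prod, Measure.prod_prod] at h
  exact h

section HausdorffDim

variable {p : ℝ≥0∞} [Fact (1 ≤ p)]

theorem volume_closedBall_le (g : LpHeisenberg p) {r : ℝ} (hr : 0 ≤ r) :
    volume (Metric.closedBall g r) ≤ ENNReal.ofReal (8 * r ^ 4) := by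
  calc volume (Metric.closedBall g r)
      ≤ volume {h : LpHeisenberg p | h.x - g.x ∈ Icc (-r) r ∧ h.y - g.y ∈ Icc (-r) r ∧
          vert g h ∈ Icc (-r ^ 2) (r ^ 2)} := by
        refine measure_mono fun h hh => ?_
        have hd : dist g h ≤ r := by rwa [dist_comm]
        refine ⟨abs_le.1 ((abs_x_sub_le_dist g h).trans hd),
          abs_le.1 ((abs_y_sub_le_dist g h).trans hd), abs_le.1 ?_⟩
        exact (abs_vert_le_dist_sq g h).trans (by gcongr)
    _ = ENNReal.ofReal (8 * r ^ 4) := by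
        rw [volume_leftBox p g measurableSet_Icc measurableSet_Icc measurableSet_Icc,
          Real.volume_Icc, Real.volume_Icc, ← ENNReal.ofReal_mul (by nlinarith [sq_nonneg r]),
          ← ENNReal.ofReal_mul (by linarith)]
        congr 1
        ring

theorem volume_closedBall_ne_zero (g : LpHeisenberg p) {r : ℝ} (hr : 0 < r) :
    volume (Metric.closedBall g r) ≠ 0 := by
  -- 38 = 1 + 6 + 31 is the sum of the coefficients in `dist_le`.
  set e := r / 38 with he
  have he0 : 0 < e := by positivity
  have hsub : {h : LpHeisenberg p | h.x - g.x ∈ Icc (-e) e ∧ h.y - g.y ∈ Icc (-e) e ∧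
      vert g h ∈ Icc (-e ^ 2) (e ^ 2)} ⊆ Metric.closedBall g r := by
    rintro h ⟨hx, hy, hv⟩
    have hs : √|vert g h| ≤ e := Real.sqrt_le_iff.2 ⟨he0.le, abs_le.2 hv⟩
    rw [Metric.mem_closedBall']
    linarith [dist_le g h, abs_le.2 hx, abs_le.2 hy]
  refine fun h0 => ?_
  have := measure_mono_null hsub h0
  rw [volume_leftBox p g measurableSet_Icc measurableSet_Icc measurableSet_Icc,
    Real.volume_Icc, Real.volume_Icc] at this
  simp only [mul_eq_zero, ENNReal.ofReal_eq_zero] at this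
  rcases this with h | h | h <;> nlinarith [sq_nonneg e]

/-! ### Hausdorff dimension -/

/-! ### Lower bound for the Hausdorff dimension: mass distribution -/

/-- A set lies in the closed ball about any of its points with radius its diameter, so its volume is
at most `8 * diam ^ 4`. -/
theorem volume_le_hausdorffMeasure :
    (8 : ℝ≥0∞)⁻¹ • (volume : Measure (LpHeisenberg p)) ≤ μH[4] := by
  -- The threshold 1 on diameters serves only to make them finite.
  refine Measure.le_hausdorffMeasure 4 _ 1 one_pos fun s hs => ?_
  rcases s.eq_empty_or_nonempty with rfl | ⟨g, hg⟩
  · simp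
  have hfin : Metric.ediam s ≠ ∞ := (hs.trans_lt ENNReal.one_lt_top).ne
  have hsub : s ⊆ Metric.closedBall g (Metric.diam s) := fun h hh =>
    Metric.dist_le_diam_of_mem' hfin hh hg
  rw [Measure.smul_apply, smul_eq_mul, ENNReal.inv_mul_le_iff (by norm_num) (by norm_num)]
  refine (measure_mono hsub).trans ((volume_closedBall_le g Metric.diam_nonneg).trans ?_)
  rw [ENNReal.ofReal_mul (by norm_num), ENNReal.ofReal_pow Metric.diam_nonneg, Metric.diam,
    ENNReal.ofReal_toReal hfin]
  have : (4 : ℝ) = (4 : ℕ) := by norm_num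
  rw [this, ENNReal.rpow_natCast]
  norm_num

theorem four_le_dimH : 4 ≤ dimH (univ : Set (LpHeisenberg p)) := by
  have h : μH[((4 : ℝ≥0) : ℝ)] (univ : Set (LpHeisenberg p)) ≠ 0 := by
    intro h0
    have h1 := (Measure.le_iff'.1 (volume_le_hausdorffMeasure (p := p))) univ
    have h2 : μH[(4 : ℝ)] (univ : Set (LpHeisenberg p)) = 0 := h0
    rw [h2, nonpos_iff_eq_zero, Measure.smul_apply, smul_eq_mul] at h1
    have h3 : volume (univ : Set (LpHeisenberg p)) = 0 := by simpa using h1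
    exact volume_closedBall_ne_zero (1 : LpHeisenberg p) one_pos
      (measure_mono_null (subset_univ _) h3)
  simpa using le_dimH_of_hausdorffMeasure_ne_zero h

/-! ### Upper bound for the Hausdorff dimension: covering by a sheared grid -/

/-- The cell of the left-invariant grid of mesh `1 / N` with index `c`. -/
def gridCell (p : ℝ≥0∞) (N : ℝ) (c : ℤ × ℤ × ℤ) : Set (LpHeisenberg p) :=
  {h | ⌊N * h.x⌋ = c.1 ∧ ⌊N * h.y⌋ = c.2.1 ∧
    ⌊N ^ 2 * (h.z - (c.1 / N * h.y - c.2.1 / N * h.x) / 2)⌋ = c.2.2}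

theorem abs_sub_le_of_floor_eq {a b : ℝ} {k : ℤ} (ha : ⌊a⌋ = k) (hb : ⌊b⌋ = k) :
    |a - b| ≤ 1 :=
  (Int.abs_sub_lt_one_of_floor_eq_floor (ha.trans hb.symm)).le

/-- The third index of a cell records the vertical coordinate relative to the corner `(c.1 / N,
c.2.1 / N, 0)`. A cell therefore sits in a left-translated box with sides of order `1 / N`, `1 / N`,
`1 / N ^ 2`, whereas a Euclidean box of these sides away from the origin would be too wide for `d`.
-/
theorem dist_le_of_mem_gridCell {N : ℝ} (hN : 0 < N) {c : ℤ × ℤ × ℤ} {g h : LpHeisenberg p}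
    (hg : g ∈ gridCell p N c) (hh : h ∈ gridCell p N c) : dist g h ≤ 69 / N := by
  obtain ⟨gx, gy, gz⟩ := hg
  obtain ⟨hx, hy, hz⟩ := hh
  have ex := abs_sub_le_of_floor_eq hx gx
  have ey := abs_sub_le_of_floor_eq hy gy
  have ez := abs_sub_le_of_floor_eq hz gz
  have fx : |N * g.x - c.1| ≤ 1 := by
    rw [← gx]; exact abs_le.2 ⟨by linarith [Int.floor_le (N * g.x)],
      by linarith [Int.lt_floor_add_one (N * g.x)]⟩
  have fy : |N * g.y - c.2.1| ≤ 1 := by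
    rw [← gy]; exact abs_le.2 ⟨by linarith [Int.floor_le (N * g.y)],
      by linarith [Int.lt_floor_add_one (N * g.y)]⟩
  have dx : |h.x - g.x| ≤ 1 / N := by
    rw [← mul_sub, abs_mul, abs_of_pos hN] at ex
    rw [le_div_iff₀ hN]
    linarith
  have dy : |h.y - g.y| ≤ 1 / N := by
    rw [← mul_sub, abs_mul, abs_of_pos hN] at ey
    rw [le_div_iff₀ hN]
    linarith
  -- Moving the base point from the corner to `g` costs a bilinear term, each of whose factors is at
  -- most 1 after scaling.
  have key : N ^ 2 * vert g h
      = (N ^ 2 * (h.z - (c.1 / N * h.y - c.2.1 / N * h.x) / 2)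
        - N ^ 2 * (g.z - (c.1 / N * g.y - c.2.1 / N * g.x) / 2))
        - ((N * g.x - c.1) * (N * h.y - N * g.y) - (N * g.y - c.2.1) * (N * h.x - N * g.x)) / 2 := by
    simp only [vert]
    field_simp
    ring
  have m1 : |(N * g.x - c.1) * (N * h.y - N * g.y)| ≤ 1 := by
    rw [abs_mul]; exact mul_le_one₀ fx (abs_nonneg _) ey
  have m2 : |(N * g.y - c.2.1) * (N * h.x - N * g.x)| ≤ 1 := by
    rw [abs_mul]; exact mul_le_one₀ fy (abs_nonneg _) ex
  have hv : |N ^ 2 * vert g h| ≤ 2 := by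
    rw [key]
    rw [abs_le] at *
    constructor <;> linarith [ez.1, ez.2, m1.1, m1.2, m2.1, m2.2]
  have hs : √|vert g h| ≤ 2 / N := by
    refine Real.sqrt_le_iff.2 ⟨by positivity, ?_⟩
    rw [abs_mul, abs_of_pos (by positivity : 0 < N ^ 2)] at hv
    rw [div_pow, le_div_iff₀ (by positivity)]
    linarith
  -- 69 = 1 + 6 + 31 * 2; the factor 2 generously replaces `√2`.
  calc dist g h ≤ |h.x - g.x| + 6 * |h.y - g.y| + 31 * √|vert g h| := dist_le g h
    _ ≤ 1 / N + 6 * (1 / N) + 31 * (2 / N) := by gcongr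
    _ = 69 / N := by ring

/-- The indices of the grid cells of mesh `1 / N` that meet the coordinate cube of size `M`. -/
noncomputable def gridIndices (M N : ℕ) : Finset (ℤ × ℤ × ℤ) :=
  Finset.Icc (-(N * M : ℤ)) (N * M) ×ˢ (Finset.Icc (-(N * M : ℤ)) (N * M) ×ˢ
    Finset.Icc (-(N ^ 2 * (M + M ^ 2) : ℤ)) (N ^ 2 * (M + M ^ 2)))

theorem card_gridIndices_le {M N : ℕ} (hM : 1 ≤ M) (hN : 1 ≤ N) :
    (gridIndices M N).card ≤ 54 * M ^ 4 * N ^ 4 := by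
  have h1 : 1 ≤ N * M := Nat.one_le_iff_ne_zero.2 (by positivity)
  have h2 : 1 ≤ N ^ 2 * (M + M ^ 2) := Nat.one_le_iff_ne_zero.2 (by positivity)
  have h3 : N ^ 2 * (M + M ^ 2) ≤ N ^ 2 * (2 * M ^ 2) := by gcongr; nlinarith
  have c1 : (Finset.Icc (-(N * M : ℤ)) (N * M)).card ≤ 3 * (N * M) := by
    rw [Int.card_Icc, Int.toNat_le]; push_cast
    have : (1 : ℤ) ≤ N * M := by exact_mod_cast h1
    linarith
  have c2 : (Finset.Icc (-(N ^ 2 * (M + M ^ 2) : ℤ)) (N ^ 2 * (M + M ^ 2))).card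
      ≤ 3 * (N ^ 2 * (2 * M ^ 2)) := by
    rw [Int.card_Icc, Int.toNat_le]; push_cast
    have : (1 : ℤ) ≤ N ^ 2 * (M + M ^ 2) := by exact_mod_cast h2
    have : (N : ℤ) ^ 2 * (M + M ^ 2) ≤ N ^ 2 * (2 * M ^ 2) := by exact_mod_cast h3
    linarith
  rw [gridIndices, Finset.card_product, Finset.card_product]
  calc _ ≤ 3 * (N * M) * (3 * (N * M) * (3 * (N ^ 2 * (2 * M ^ 2)))) := by gcongr
    _ = _ := by ring

theorem floor_mem_Icc {a : ℝ} {k : ℤ} (h : |a| ≤ k) : ⌊a⌋ ∈ Finset.Icc (-k) k := by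
  rw [abs_le] at h
  rw [Finset.mem_Icc]
  refine ⟨Int.le_floor.2 (by push_cast; exact h.1), ?_⟩
  exact_mod_cast (Int.floor_le a).trans h.2

/-- Since `-N * M` is an integer, rounding down keeps the corner coordinates within `[-M, M]`. The
shear then changes `z` by at most `(M * M + M * M) / 2`, hence the vertical range `M + M ^ 2` of the
indices. -/
theorem cube_subset_gridCell (q : ℝ≥0∞) (M : ℕ) {N : ℕ} (hN : 1 ≤ N) :
    {h : LpHeisenberg q | |h.x| ≤ M ∧ |h.y| ≤ M ∧ |h.z| ≤ M} ⊆
      ⋃ c : gridIndices M N, gridCell q N c := by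
  rintro h ⟨hx, hy, hz⟩
  have hN0 : (0 : ℝ) < N := by exact_mod_cast hN
  have ax : |N * h.x| ≤ ((N * M : ℤ) : ℝ) := by
    push_cast; rw [abs_mul, abs_of_pos hN0]; gcongr
  have ay : |N * h.y| ≤ ((N * M : ℤ) : ℝ) := by
    push_cast; rw [abs_mul, abs_of_pos hN0]; gcongr
  have key {a : ℝ} (ha : |N * a| ≤ ((N * M : ℤ) : ℝ)) : |(⌊N * a⌋ : ℝ) / N| ≤ M := by
    have := Finset.mem_Icc.1 (floor_mem_Icc ha)
    have h1 : (-(N * M) : ℝ) ≤ ⌊N * a⌋ := by exact_mod_cast this.1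
    have h2 : (⌊N * a⌋ : ℝ) ≤ N * M := by exact_mod_cast this.2
    rw [abs_div, abs_of_pos hN0, div_le_iff₀ hN0]
    exact abs_le.2 ⟨by linarith, by linarith⟩
  have az : |(N : ℝ) ^ 2 * (h.z - (⌊N * h.x⌋ / N * h.y - ⌊N * h.y⌋ / N * h.x) / 2)|
      ≤ ((N ^ 2 * (M + M ^ 2) : ℤ) : ℝ) := by
    push_cast
    rw [abs_mul, abs_of_pos (by positivity : (0 : ℝ) < N ^ 2)]
    gcongr
    have m1 : |(⌊N * h.x⌋ : ℝ) / N * h.y| ≤ M * M := by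
      rw [abs_mul]; gcongr; exact key ax
    have m2 : |(⌊N * h.y⌋ : ℝ) / N * h.x| ≤ M * M := by
      rw [abs_mul]; gcongr; exact key ay
    rw [abs_le] at *
    constructor <;> nlinarith
  refine mem_iUnion.2 ⟨⟨(⌊N * h.x⌋, ⌊N * h.y⌋,
    ⌊(N : ℝ) ^ 2 * (h.z - (⌊N * h.x⌋ / N * h.y - ⌊N * h.y⌋ / N * h.x) / 2)⌋), ?_⟩, rfl, rfl, rfl⟩
  simp only [gridIndices, Finset.mem_product]
  exact ⟨floor_mem_Icc ax, floor_mem_Icc ay, floor_mem_Icc az⟩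

/-- The powers of `N` cancel: at most `54 * M ^ 4 * N ^ 4` cells each contribute at most `(69 / N) ^
4`. -/
theorem hausdorffMeasure_cube_lt_top (M : ℕ) (hM : 1 ≤ M) :
    μH[4] {h : LpHeisenberg p | |h.x| ≤ M ∧ |h.y| ≤ M ∧ |h.z| ≤ M} < ∞ := by
  have hdiam : ∀ N : ℕ, 1 ≤ N → ∀ c, Metric.ediam (gridCell p N c) ≤ ENNReal.ofReal (69 / N) :=
    fun N hN c => Metric.ediam_le fun g hg h hh => by
      rw [edist_dist]
      exact ENNReal.ofReal_le_ofReal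
        (dist_le_of_mem_gridCell (by exact_mod_cast hN) hg hh)
  have hev : ∀ᶠ N : ℕ in atTop, 1 ≤ N := eventually_ge_atTop 1
  have hlim : Tendsto (fun N : ℕ => ENNReal.ofReal (69 / N)) atTop (𝓝 0) := by
    have := ENNReal.tendsto_ofReal (tendsto_const_div_atTop_nhds_zero_nat (69 : ℝ))
    simpa using this
  refine (Measure.hausdorffMeasure_le_liminf_sum (ι := fun N : ℕ => gridIndices M N) 4 _
    (fun N : ℕ => ENNReal.ofReal (69 / N)) hlim (fun N c => gridCell p N c)
    (hev.mono fun N hN c => hdiam N hN c)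
    (hev.mono fun N hN => cube_subset_gridCell p M hN)).trans_lt ?_
  refine lt_of_le_of_lt (b := ENNReal.ofReal (54 * (M : ℝ) ^ 4 * 69 ^ 4)) ?_ ENNReal.ofReal_lt_top
  refine liminf_le_of_frequently_le' (Eventually.frequently ?_)
  filter_upwards [hev] with N hN
  have hN0 : (0 : ℝ) < N := by exact_mod_cast hN
  calc ∑ c : gridIndices M N, Metric.ediam (gridCell p N c) ^ (4 : ℝ)
      ≤ ∑ _c : gridIndices M N, ENNReal.ofReal ((69 / N) ^ 4) := by
        refine Finset.sum_le_sum fun c _ => ?_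
        have : (4 : ℝ) = (4 : ℕ) := by norm_num
        rw [this, ENNReal.rpow_natCast, ENNReal.ofReal_pow (by positivity)]
        gcongr
        exact hdiam N hN c
    _ = ENNReal.ofReal ((gridIndices M N).card * (69 / N) ^ 4) := by
        rw [Finset.sum_const, nsmul_eq_mul, ENNReal.ofReal_mul (by positivity),
          ENNReal.ofReal_natCast, Finset.card_univ, Fintype.card_coe]
    _ ≤ ENNReal.ofReal (54 * (M : ℝ) ^ 4 * 69 ^ 4) := by
        refine ENNReal.ofReal_le_ofReal ?_
        have hc : ((gridIndices M N).card : ℝ) ≤ 54 * M ^ 4 * N ^ 4 := by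
          exact_mod_cast card_gridIndices_le hM hN
        calc ((gridIndices M N).card : ℝ) * (69 / N) ^ 4
            ≤ 54 * (M : ℝ) ^ 4 * N ^ 4 * (69 / N) ^ 4 := by gcongr
          _ = 54 * (M : ℝ) ^ 4 * 69 ^ 4 := by field_simp

theorem dimH_le_four : dimH (univ : Set (LpHeisenberg p)) ≤ 4 := by
  have hU : (univ : Set (LpHeisenberg p)) =
      ⋃ n : ℕ, {h | |h.x| ≤ ((n + 1 : ℕ) : ℝ) ∧ |h.y| ≤ ((n + 1 : ℕ) : ℝ) ∧
        |h.z| ≤ ((n + 1 : ℕ) : ℝ)} := by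
    refine (eq_univ_of_forall fun h => mem_iUnion.2 ?_).symm
    obtain ⟨n, hn⟩ := exists_nat_ge (max |h.x| (max |h.y| |h.z|))
    simp only [max_le_iff] at hn
    refine ⟨n, ?_⟩
    simp only [mem_ofPred_eq, Nat.cast_add, Nat.cast_one]
    exact ⟨by linarith, by linarith, by linarith⟩
  rw [hU, dimH_iUnion]
  refine iSup_le fun n => ?_
  have := dimH_le_of_hausdorffMeasure_ne_top (d := 4)
    (hausdorffMeasure_cube_lt_top (p := p) (n + 1) (by omega)).ne
  simpa using this

theorem dimH_univ_eq_four : dimH (univ : Set (LpHeisenberg p)) = 4 :=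
  le_antisymm dimH_le_four four_le_dimH

end HausdorffDim

/-! ### A family of geodesics -/

/-! ### Calibrated curves -/

theorem dist_le_of_norm_velocity_le {p : ℝ≥0∞} [Fact (1 ≤ p)] {γ : ℝ → LpHeisenberg p} {L : ℝ}
    (hL : 0 ≤ L) (hγ : ∀ a b, IsHorizontalOn γ a b)
    (hv : ∀ t, ‖WithLp.toLp p ((velocity γ t).1, (velocity γ t).2.1)‖ ≤ L) (s t : ℝ) :
    dist (γ s) (γ t) ≤ L * |s - t| := by
  rcases eq_or_ne s t with rfl | hst
  · simp
  have hm : t - s ≠ 0 := sub_ne_zero.2 hst.symm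
  have h1 : edist (γ s) (γ t) ≤ ENNReal.ofReal (L * |s - t|) := by
    rw [edist_def]
    refine (iInf₂_le (fun τ => γ ((t - s) * τ + s))
      ⟨IsHorizontalOn.comp_affine hm (hγ _ _), by simp, by simp⟩).trans ?_
    rw [length_comp_affine γ hm]
    simp only [length, mul_zero, zero_add, mul_one, sub_add_cancel]
    calc ∫⁻ τ in uIcc s t, ‖WithLp.toLp p ((velocity γ τ).1, (velocity γ τ).2.1)‖ₑ
        ≤ ∫⁻ _ in uIcc s t, ENNReal.ofReal L := by
          refine lintegral_mono fun τ => ?_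
          rw [← ofReal_norm]
          exact ENNReal.ofReal_le_ofReal (hv τ)
      _ = ENNReal.ofReal (L * |s - t|) := by
          rw [setLIntegral_const, uIcc, Real.volume_Icc, max_sub_min_eq_abs', ← ENNReal.ofReal_mul hL]
  rwa [edist_dist, ENNReal.ofReal_le_ofReal_iff (by positivity)] at h1

/-- A speed bound `L` matched by a lower bound for the distance forces equality throughout. In
practice the lower bound comes from a 1-Lipschitz function growing at rate `L` along the curve. For
`t < s` the hypothesis `hd` is vacuous. -/
theorem isMinimisingGeodesic_of_calibration {p : ℝ≥0∞} [Fact (1 ≤ p)] {γ : ℝ → LpHeisenberg p}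
    {L : ℝ} (hL : 0 ≤ L) (hγ : ∀ a b, IsHorizontalOn γ a b)
    (hv : ∀ t, ‖WithLp.toLp p ((velocity γ t).1, (velocity γ t).2.1)‖ ≤ L)
    (hd : ∀ s t, L * (t - s) ≤ dist (γ s) (γ t)) :
    IsMinimisingGeodesic γ ∧ dist (γ 0) (γ 1) = L := by
  have key (s t : ℝ) : dist (γ s) (γ t) = L * |s - t| := by
    refine le_antisymm (dist_le_of_norm_velocity_le hL hγ hv s t) ?_
    rcases le_total s t with h | h
    · rw [abs_sub_comm, abs_of_nonneg (sub_nonneg.2 h)]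
      exact hd s t
    · rw [abs_of_nonneg (sub_nonneg.2 h), dist_comm]
      exact hd t s
  have h01 : dist (γ 0) (γ 1) = L := by simp [key]
  exact ⟨fun s _ t _ => by rw [key s t, h01, mul_comm], h01⟩

/-- The calibration for `ℓ¹`: along a horizontal curve, `|u₁ + u₂| ≤ |u₁| + |u₂|`. -/
theorem abs_add_sub_le_dist_one (g h : LpHeisenberg 1) :
    |(h.x + h.y) - (g.x + g.y)| ≤ dist g h := by
  have h1 : ‖(h.x + h.y) - (g.x + g.y)‖ₑ ≤ subFinslerEDist g h := by
    refine le_iInf₂ fun γ ⟨hγ, h0, h1⟩ => ?_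
    have key := enorm_sub_le_lintegral (f := fun t => (γ t).x + (γ t).y)
      (F := fun s => ‖WithLp.toLp 1 ((velocity γ s).1, (velocity γ s).2.1)‖ₑ)
      (hγ.ac_x.fun_add hγ.ac_y) ?_ (t := 1) (by norm_num)
    · simp only [h0, h1] at key
      exact key
    rw [ae_restrict_iff' measurableSet_uIcc]
    filter_upwards [hγ.ac_x.ae_differentiableAt, hγ.ac_y.ae_differentiableAt] with s dx dy hs
    rw [← ofReal_norm (WithLp.toLp 1 _), Real.enorm_eq_ofReal_abs, WithLp.prod_norm_eq_of_L1,
      ((dx hs).hasDerivAt.fun_add (dy hs).hasDerivAt).deriv]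
    exact ENNReal.ofReal_le_ofReal (abs_add_le _ _)
  rwa [← edist_def, edist_dist, Real.enorm_eq_ofReal_abs,
    ENNReal.ofReal_le_ofReal_iff dist_nonneg] at h1

/-- The horizontal curve starting from `g` whose velocity has coefficients
`aᵢ + bᵢ * cos (ω * t)` in the frame `X, Y`. -/
noncomputable def oscillatingCurve {p : ℝ≥0∞} (g : LpHeisenberg p) (a₁ b₁ a₂ b₂ ω : ℝ) (t : ℝ) :
    LpHeisenberg p :=
  g * ⟨a₁ * t + b₁ * (Real.sin (ω * t) / ω), a₂ * t + b₂ * (Real.sin (ω * t) / ω),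
    (a₁ * b₂ - a₂ * b₁) / 2 * (t * Real.sin (ω * t) / ω - 2 * (1 - Real.cos (ω * t)) / ω ^ 2)⟩

/-! ### Oscillating horizontal curves -/

section Oscillating

variable {p : ℝ≥0∞} (g : LpHeisenberg p) (a₁ b₁ a₂ b₂ : ℝ) {ω : ℝ}

theorem hasDerivAt_sin_div (hω : ω ≠ 0) (t : ℝ) :
    HasDerivAt (fun t => Real.sin (ω * t) / ω) (Real.cos (ω * t)) t := by
  have h := (((hasDerivAt_id t).const_mul ω).sin).div_const ω
  refine h.congr_deriv ?_
  simp only [id, mul_one]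
  field_simp

theorem oscillatingCurve_zero : oscillatingCurve g a₁ b₁ a₂ b₂ ω 0 = g := by
  ext <;> simp [oscillatingCurve]

theorem hasDerivAt_oscillatingCurve_x (hω : ω ≠ 0) (t : ℝ) :
    HasDerivAt (fun t => (oscillatingCurve g a₁ b₁ a₂ b₂ ω t).x)
      (a₁ + b₁ * Real.cos (ω * t)) t := by
  have h := (((hasDerivAt_id t).const_mul a₁).add
    ((hasDerivAt_sin_div hω t).const_mul b₁)).const_add g.x
  exact h.congr_deriv (by ring)

theorem hasDerivAt_oscillatingCurve_y (hω : ω ≠ 0) (t : ℝ) :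
    HasDerivAt (fun t => (oscillatingCurve g a₁ b₁ a₂ b₂ ω t).y)
      (a₂ + b₂ * Real.cos (ω * t)) t := by
  have h := (((hasDerivAt_id t).const_mul a₂).add
    ((hasDerivAt_sin_div hω t).const_mul b₂)).const_add g.y
  exact h.congr_deriv (by ring)

/-- For the curve issuing from the identity, `x y' - y x'` collapses to `(a₁ b₂ - a₂ b₁) (t cos (ω
t) - sin (ω t) / ω)`, and the vertical coordinate is half its primitive. Left translation preserves
horizontality. -/
theorem hasDerivAt_oscillatingCurve_z (hω : ω ≠ 0) (t : ℝ) :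
    HasDerivAt (fun t => (oscillatingCurve g a₁ b₁ a₂ b₂ ω t).z)
      (((oscillatingCurve g a₁ b₁ a₂ b₂ ω t).x * (a₂ + b₂ * Real.cos (ω * t))
        - (oscillatingCurve g a₁ b₁ a₂ b₂ ω t).y * (a₁ + b₁ * Real.cos (ω * t))) / 2) t := by
  have hs := (((hasDerivAt_id t).const_mul ω).sin)
  have hc := (((hasDerivAt_id t).const_mul ω).cos)
  have hx := ((hasDerivAt_id t).const_mul a₁).add ((hasDerivAt_sin_div hω t).const_mul b₁)
  have hy := ((hasDerivAt_id t).const_mul a₂).add ((hasDerivAt_sin_div hω t).const_mul b₂)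
  have h := ((((((hasDerivAt_id t).mul hs).div_const ω).sub
    (((hc.const_sub 1).const_mul 2).div_const (ω ^ 2))).const_mul
      ((a₁ * b₂ - a₂ * b₁) / 2)).const_add g.z).add
    (((hy.const_mul g.x).sub (hx.mul_const g.y)).div_const 2)
  refine h.congr_deriv ?_
  simp only [oscillatingCurve, mul_x, mul_y, id]
  field_simp
  ring

theorem velocity_oscillatingCurve (hω : ω ≠ 0) (t : ℝ) :
    ((velocity (oscillatingCurve g a₁ b₁ a₂ b₂ ω) t).1,
      (velocity (oscillatingCurve g a₁ b₁ a₂ b₂ ω) t).2.1) =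
      (a₁ + b₁ * Real.cos (ω * t), a₂ + b₂ * Real.cos (ω * t)) := by
  simp only [velocity]
  rw [(hasDerivAt_oscillatingCurve_x g a₁ b₁ a₂ b₂ hω t).deriv,
    (hasDerivAt_oscillatingCurve_y g a₁ b₁ a₂ b₂ hω t).deriv]

theorem isHorizontalOn_oscillatingCurve (hω : ω ≠ 0) (a b : ℝ) :
    IsHorizontalOn (oscillatingCurve g a₁ b₁ a₂ b₂ ω) a b where
  ac_x := ContDiffOn.absolutelyContinuousOnInterval (ContDiff.contDiffOn (by
    simp only [oscillatingCurve, mul_x]; fun_prop))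
  ac_y := ContDiffOn.absolutelyContinuousOnInterval (ContDiff.contDiffOn (by
    simp only [oscillatingCurve, mul_y]; fun_prop))
  ac_z := ContDiffOn.absolutelyContinuousOnInterval (ContDiff.contDiffOn (by
    simp only [oscillatingCurve, mul_z]; fun_prop))
  horizontal := ae_of_all _ fun t => by
    rw [horizontal_iff, (hasDerivAt_oscillatingCurve_x g a₁ b₁ a₂ b₂ hω t).deriv,
      (hasDerivAt_oscillatingCurve_y g a₁ b₁ a₂ b₂ hω t).deriv,
      (hasDerivAt_oscillatingCurve_z g a₁ b₁ a₂ b₂ hω t).deriv]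

/-- At a half period the horizontal displacement forgets the oscillation, while the enclosed area is
linear in its amplitude. Displacement and height can thus be prescribed separately. -/
theorem oscillatingCurve_half_period (hω : ω ≠ 0) {t : ℝ} (ht : ω * t = Real.pi) :
    oscillatingCurve g a₁ b₁ a₂ b₂ ω t =
      g * ⟨a₁ * t, a₂ * t, -(2 * (a₁ * b₂ - a₂ * b₁) / ω ^ 2)⟩ := by
  simp only [oscillatingCurve, ht, Real.sin_pi, Real.cos_pi]
  congr 2
  · simp
  · simp
  · field_simp
    ring

end Oscillating

/-! ### Minimality for the two norms -/

/-- The opposite oscillations cancel in `x + y`, and the amplitude bounds keep both controls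
nonnegative, so the `ℓ¹` speed is constantly `a₁ + a₂`. -/
theorem isMinimisingGeodesic_oscillatingCurve_one (g : LpHeisenberg 1) {a₁ a₂ b ω : ℝ} (hω : ω ≠ 0)
    (h₁ : |b| ≤ a₁) (h₂ : |b| ≤ a₂) :
    IsMinimisingGeodesic (oscillatingCurve g a₁ b a₂ (-b) ω) ∧
      dist (oscillatingCurve g a₁ b a₂ (-b) ω 0) (oscillatingCurve g a₁ b a₂ (-b) ω 1)
        = a₁ + a₂ := by
  have hb0 := abs_nonneg b
  refine isMinimisingGeodesic_of_calibration (by linarith)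
    (isHorizontalOn_oscillatingCurve _ _ _ _ _ hω) (fun t => ?_) fun s t => ?_
  · rw [velocity_oscillatingCurve g _ _ _ _ hω, WithLp.prod_norm_eq_of_L1]
    simp only [WithLp.toLp_fst, WithLp.toLp_snd, Real.norm_eq_abs]
    have hc : |b * Real.cos (ω * t)| ≤ |b| := by
      rw [abs_mul]; exact mul_le_of_le_one_right hb0 (Real.abs_cos_le_one _)
    rw [abs_le] at hc
    rw [abs_of_nonneg (by linarith), abs_of_nonneg (by linarith)]
    linarith
  · refine le_trans (le_trans (le_of_eq ?_) (le_abs_self _)) (abs_add_sub_le_dist_one _ _)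
    simp only [oscillatingCurve, mul_x, mul_y]
    ring

/-- Only the second control oscillates, and it never exceeds the constant first one in absolute
value, so `x` calibrates the curve. -/
theorem isMinimisingGeodesic_oscillatingCurve_top (g : LpHeisenberg ∞) {a₁ a₂ b ω : ℝ} (hω : ω ≠ 0)
    (h : |a₂| + |b| ≤ a₁) :
    IsMinimisingGeodesic (oscillatingCurve g a₁ 0 a₂ b ω) ∧
      dist (oscillatingCurve g a₁ 0 a₂ b ω 0) (oscillatingCurve g a₁ 0 a₂ b ω 1) = a₁ := by
  have hb0 := abs_nonneg b
  have ha0 := abs_nonneg a₂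
  refine isMinimisingGeodesic_of_calibration (by linarith)
    (isHorizontalOn_oscillatingCurve _ _ _ _ _ hω) (fun t => ?_) fun s t => ?_
  · rw [velocity_oscillatingCurve g _ _ _ _ hω, WithLp.prod_norm_eq_sup]
    simp only [WithLp.toLp_fst, WithLp.toLp_snd, Real.norm_eq_abs]
    have hc : |b * Real.cos (ω * t)| ≤ |b| := by
      rw [abs_mul]; exact mul_le_of_le_one_right hb0 (Real.abs_cos_le_one _)
    refine max_le (by rw [zero_mul, add_zero, abs_of_nonneg (by linarith)]) ?_
    linarith [abs_add_le a₂ (b * Real.cos (ω * t))]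
  · refine le_trans (le_trans (le_of_eq ?_) (le_abs_self _)) (abs_x_sub_le_dist _ _)
    simp only [oscillatingCurve, mul_x]
    ring

/-! ### Geodesic dimension -/

section GeodesicDim

variable {p : ℝ≥0∞} [Fact (1 ≤ p)]

/-! ### Lower bound for the geodesic dimension -/

theorem _root_.intermediateSet_subset_closedBall {X : Type*} [MetricSpace X] {x : X} {Ω : Set X} {R t : ℝ}
    (hΩ : Ω ⊆ Metric.closedBall x R) (ht : t ∈ Icc (0 : ℝ) 1) :
    intermediateSet x Ω t ⊆ Metric.closedBall x (t * R) := by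
  rintro y ⟨γ, hγ, rfl, h1, rfl⟩
  have h := hγ 0 (by simp) t ht
  rw [zero_sub, abs_neg, abs_of_nonneg ht.1] at h
  rw [Metric.mem_closedBall', h]
  exact mul_le_mul_of_nonneg_left (Metric.mem_closedBall'.1 (hΩ h1)) ht.1

theorem contractionRate_eq_zero (g : LpHeisenberg p) {s : ℝ≥0} (hs : s < 4)
    {Ω : Set (LpHeisenberg p)} (hb : Bornology.IsBounded Ω) (h0 : volume Ω ≠ 0) :
    contractionRate volume g s Ω = 0 := by
  obtain ⟨R, hR0, hR⟩ := hb.subset_closedBall_lt 0 g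
  have hs' : (0 : ℝ) < 4 - s := sub_pos.2 (by exact_mod_cast hs)
  have hlim : Tendsto (fun t : ℝ => ENNReal.ofReal (t ^ (4 - s : ℝ) * (8 * R ^ 4)) / volume Ω)
      (𝓝[>] 0) (𝓝 0) := by
    have h1 : Tendsto (fun t : ℝ => t ^ (4 - s : ℝ) * (8 * R ^ 4)) (𝓝[>] 0) (𝓝 0) := by
      have := (Real.continuousAt_rpow_const (0 : ℝ) (4 - s : ℝ) (Or.inr hs'.le)).tendsto
      rw [Real.zero_rpow hs'.ne'] at this
      simpa using (this.mono_left nhdsWithin_le_nhds).mul_const (8 * R ^ 4)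
    have h2 := ENNReal.Tendsto.div_const (ENNReal.tendsto_ofReal h1) (b := volume Ω) (Or.inr h0)
    simpa using h2
  refine (tendsto_of_tendsto_of_tendsto_of_le_of_le' tendsto_const_nhds hlim
    (Eventually.of_forall fun _ => zero_le) ?_).limsup_eq
  -- Only times below 1 belong to the geodesics, and they suffice for the limit at 0.
  filter_upwards [Ioo_mem_nhdsGT (zero_lt_one (α := ℝ))] with t ht
  have ht0 : 0 < t := ht.1
  have hts : 0 < t ^ (s : ℝ) := Real.rpow_pos_of_pos ht0 _
  have hvol : volume (intermediateSet g Ω t) ≤ ENNReal.ofReal (8 * (t * R) ^ 4) :=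
    (measure_mono (intermediateSet_subset_closedBall hR ⟨ht0.le, ht.2.le⟩)).trans
      (volume_closedBall_le g (by positivity))
  calc (ENNReal.ofReal (t ^ (s : ℝ)))⁻¹ * (volume (intermediateSet g Ω t) / volume Ω)
      ≤ ENNReal.ofReal (t ^ (s : ℝ))⁻¹ * (ENNReal.ofReal (8 * (t * R) ^ 4) / volume Ω) := by
        rw [ENNReal.ofReal_inv_of_pos hts]
        gcongr
    _ = ENNReal.ofReal (t ^ (4 - s : ℝ) * (8 * R ^ 4)) / volume Ω := by
        rw [← mul_div_assoc, ← ENNReal.ofReal_mul (by positivity), Real.rpow_sub ht0]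
        congr 2
        have : t ^ (4 : ℝ) = t ^ 4 := by exact_mod_cast Real.rpow_natCast t 4
        rw [this]
        field_simp

theorem four_le_geodesicDimAt (g : LpHeisenberg p) : 4 ≤ geodesicDimAt volume g := by
  rw [geodesicDimAt_eq_iSup]
  refine le_of_forall_lt fun a ha => ?_
  obtain ⟨s, has, hs⟩ := ENNReal.lt_iff_exists_nnreal_btwn.1 ha
  have hs0 : 0 < s := by exact_mod_cast zero_le.trans_lt has
  refine has.trans_le (le_iSup₂_of_le s ⟨hs0, ?_⟩ le_rfl)
  simp only [contractionSup, ENNReal.iSup_eq_zero]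
  exact fun Ω hΩ => contractionRate_eq_zero g (by exact_mod_cast hs) hΩ.2.1 hΩ.2.2.1

/-! ### Upper bound for the geodesic dimension -/

/-- From every point `g`, geodesics of bounded length reach at time `t` all the points of a fixed
box dilated by the factor `t`. -/
def HasDilatedGeodesics (p : ℝ≥0∞) [Fact (1 ≤ p)] : Prop :=
  ∀ (g : LpHeisenberg p) (t a₁ a₂ c : ℝ), 0 < t → a₁ ∈ Icc (1 : ℝ) 2 →
    a₂ ∈ Icc (1 / 4 : ℝ) (1 / 2) → c ∈ Icc (-(1 / 20) : ℝ) (1 / 20) →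
    ∃ γ : ℝ → LpHeisenberg p, IsMinimisingGeodesic γ ∧ γ 0 = g ∧ dist (γ 0) (γ 1) ≤ 3 ∧
      γ t = g * ⟨a₁ * t, a₂ * t, c * t ^ 2⟩

/-- The points reached fill a left-translated box with sides `t`, `t / 4`, `t ^ 2 / 10`, of volume
`t ^ 4 / 40`. -/
theorem HasDilatedGeodesics.le_volume_intermediateSet (H : HasDilatedGeodesics p)
    (g : LpHeisenberg p) {t : ℝ} (ht : 0 < t) :
    ENNReal.ofReal (t ^ 4 * (1 / 40)) ≤
      volume (intermediateSet g (Metric.closedBall g 3) t) := by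
  have ht2 : 0 < t ^ 2 := by positivity
  calc ENNReal.ofReal (t ^ 4 * (1 / 40))
      = volume {h : LpHeisenberg p | h.x - g.x ∈ Icc (1 * t) (2 * t) ∧
          h.y - g.y ∈ Icc (1 / 4 * t) (1 / 2 * t) ∧
          vert g h ∈ Icc (-(1 / 20) * t ^ 2) (1 / 20 * t ^ 2)} := by
        rw [volume_leftBox p g measurableSet_Icc measurableSet_Icc measurableSet_Icc,
          Real.volume_Icc, Real.volume_Icc, Real.volume_Icc,
          ← ENNReal.ofReal_mul (by linarith), ← ENNReal.ofReal_mul (by linarith)]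
        congr 1
        ring
    _ ≤ _ := by
        refine measure_mono ?_
        rintro h ⟨hx, hy, hv⟩
        obtain ⟨γ, hγ, h0, h1, hγt⟩ := H g t ((h.x - g.x) / t) ((h.y - g.y) / t)
          (vert g h / t ^ 2) ht
          ⟨(le_div_iff₀ ht).2 hx.1, (div_le_iff₀ ht).2 hx.2⟩
          ⟨(le_div_iff₀ ht).2 hy.1, (div_le_iff₀ ht).2 hy.2⟩
          ⟨(le_div_iff₀ ht2).2 hv.1, (div_le_iff₀ ht2).2 hv.2⟩
        refine ⟨γ, hγ, h0, ?_, ?_⟩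
        · rwa [Metric.mem_closedBall', ← h0]
        · rw [hγt, div_mul_cancel₀ _ ht.ne', div_mul_cancel₀ _ ht.ne', div_mul_cancel₀ _ ht2.ne']
          ext
          · simp
          · simp
          · simp only [mul_z, vert]; ring

theorem HasDilatedGeodesics.contractionSup_ne_zero (H : HasDilatedGeodesics p)
    (g : LpHeisenberg p) : contractionSup volume g 4 ≠ 0 := by
  have hne : volume (Metric.closedBall g 3) ≠ 0 := volume_closedBall_ne_zero g (by norm_num)
  have hfin : volume (Metric.closedBall g 3) ≠ ∞ :=
    ((volume_closedBall_le g (by norm_num)).trans_lt ENNReal.ofReal_lt_top).ne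
  have hpos : 0 < ENNReal.ofReal (1 / 40) / volume (Metric.closedBall g 3) :=
    ENNReal.div_pos (by simp) hfin
  refine (hpos.trans_le (le_iSup₂_of_le (Metric.closedBall g 3)
    ⟨Metric.isClosed_closedBall.measurableSet, Metric.isBounded_closedBall, hne, hfin⟩ ?_)).ne'
  refine le_limsup_of_frequently_le (Eventually.frequently ?_) (by isBoundedDefault)
  filter_upwards [self_mem_nhdsWithin] with t ht
  have ht0 : 0 < t := ht
  have hpow : t ^ ((4 : ℝ≥0) : ℝ) = t ^ 4 := by simp
  have ht4 : ENNReal.ofReal (t ^ 4) ≠ 0 := by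
    rw [ne_eq, ENNReal.ofReal_eq_zero, not_le]; positivity
  rw [hpow]
  calc ENNReal.ofReal (1 / 40) / volume (Metric.closedBall g 3)
      = (ENNReal.ofReal (t ^ 4))⁻¹ *
        (ENNReal.ofReal (t ^ 4 * (1 / 40)) / volume (Metric.closedBall g 3)) := by
        rw [ENNReal.ofReal_mul (by positivity), ← mul_div_assoc, ← mul_assoc,
          ENNReal.inv_mul_cancel ht4 ENNReal.ofReal_ne_top, one_mul]
    _ ≤ _ := by
        gcongr
        exact H.le_volume_intermediateSet g ht0

theorem HasDilatedGeodesics.geodesicDim_eq_four (H : HasDilatedGeodesics p) :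
    geodesicDim (volume : Measure (LpHeisenberg p)) = 4 := by
  refine le_antisymm (iSup_le fun g => ?_)
    ((four_le_geodesicDimAt (1 : LpHeisenberg p)).trans (le_iSup (geodesicDimAt volume) 1))
  refine ENNReal.le_of_forall_pos_le_add fun ε hε _ => ?_
  -- It is enough that `C_4` is nonzero: any larger exponent then gives `∞`.
  have h := contractionSup_eq_top_of_lt (lt_add_of_pos_right 4 hε) (H.contractionSup_ne_zero g)
  exact (iInf₂_le (4 + ε) ⟨by positivity, h⟩).trans (by simp)

end GeodesicDim

/-! ### The two norms -/

theorem hasDilatedGeodesics_one : HasDilatedGeodesics 1 := by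
  intro g t a₁ a₂ c ht h₁ h₂ hc
  -- The frequency depends on `t`, so that time `t` is exactly a half period: a different geodesic
  -- is used for each `t`.
  have hω : Real.pi / t ≠ 0 := by positivity
  have hωt : Real.pi / t * t = Real.pi := div_mul_cancel₀ _ ht.ne'
  have ha : 0 < a₁ + a₂ := by linarith [h₁.1, h₂.1]
  -- The amplitude solves `2 * b * (a₁ + a₂) / ω ^ 2 = c * t ^ 2` with `ω = π / t`; the powers of
  -- `t` cancel.
  set b := c * Real.pi ^ 2 / (2 * (a₁ + a₂)) with hb
  have hb1 : |b| ≤ 1 / 4 := by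
    rw [hb, abs_div, abs_of_pos (by linarith : 0 < 2 * (a₁ + a₂)), div_le_iff₀ (by linarith),
      abs_mul, abs_of_pos (by positivity : 0 < Real.pi ^ 2)]
    have hπ : Real.pi ^ 2 ≤ 10 := by nlinarith [Real.pi_lt_d2, Real.pi_pos]
    have : |c| * Real.pi ^ 2 ≤ 1 / 20 * 10 := by
      gcongr
      exact abs_le.2 hc
    linarith [h₁.1, h₂.1]
  obtain ⟨hγ, hd⟩ := isMinimisingGeodesic_oscillatingCurve_one g (a₁ := a₁) (a₂ := a₂) (b := b) hω
    (by linarith [h₁.1]) (by linarith [h₂.1])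
  refine ⟨_, hγ, oscillatingCurve_zero _ _ _ _ _, hd.trans_le (by linarith [h₁.2, h₂.2]), ?_⟩
  rw [oscillatingCurve_half_period _ _ _ _ _ hω hωt, hb]
  congr 2
  field_simp
  ring

theorem hasDilatedGeodesics_top : HasDilatedGeodesics ∞ := by
  intro g t a₁ a₂ c ht h₁ h₂ hc
  have hω : Real.pi / t ≠ 0 := by positivity
  have hωt : Real.pi / t * t = Real.pi := div_mul_cancel₀ _ ht.ne'
  have ha : 0 < a₁ := by linarith [h₁.1]
  -- Here the height at the half period is `-2 * a₁ * b / ω ^ 2`, hence the sign. With `π ^ 2 ≤ 10`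
  -- and `|c| ≤ 1 / 20` this gives `|b| ≤ 1 / 4`, so `|a₂| + |b| ≤ 3 / 4 < a₁`.
  set b := -(c * Real.pi ^ 2 / (2 * a₁)) with hb
  have hb1 : |b| ≤ 1 / 4 := by
    rw [hb, abs_neg, abs_div, abs_of_pos (by linarith : 0 < 2 * a₁), div_le_iff₀ (by linarith),
      abs_mul, abs_of_pos (by positivity : 0 < Real.pi ^ 2)]
    have hπ : Real.pi ^ 2 ≤ 10 := by nlinarith [Real.pi_lt_d2, Real.pi_pos]
    have : |c| * Real.pi ^ 2 ≤ 1 / 20 * 10 := by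
      gcongr
      exact abs_le.2 hc
    linarith [h₁.1]
  obtain ⟨hγ, hd⟩ := isMinimisingGeodesic_oscillatingCurve_top g (a₁ := a₁) (a₂ := a₂) (b := b) hω
    (by rw [abs_of_nonneg (by linarith [h₂.1])]; linarith [h₁.1, h₂.2])
  refine ⟨_, hγ, oscillatingCurve_zero _ _ _ _ _, hd.trans_le (by linarith [h₁.2]), ?_⟩
  rw [oscillatingCurve_half_period _ _ _ _ _ hω hωt, hb]
  congr 2
  field_simp
  ring

end LpHeisenberg

theorem mainTheorem5 :
    (geodesicDim (volume : Measure (LpHeisenberg 1)) = 4 ∧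
      dimH (univ : Set (LpHeisenberg 1)) = 4) ∧
    (geodesicDim (volume : Measure (LpHeisenberg ∞)) = 4 ∧
      dimH (univ : Set (LpHeisenberg ∞)) = 4) :=
  ⟨⟨LpHeisenberg.hasDilatedGeodesics_one.geodesicDim_eq_four, LpHeisenberg.dimH_univ_eq_four⟩,
    LpHeisenberg.hasDilatedGeodesics_top.geodesicDim_eq_four, LpHeisenberg.dimH_univ_eq_four⟩
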